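/- All $\lambda$-terms are pure untyped $\lambda$-terms, and $F,G,H,J,M,N,P,Q,R$ denote closed terms. Write $\twoheadrightarrow_{\beta}$, $\twoheadrightarrow_{\eta}$, $\twoheadrightarrow_{\beta\eta}$ for reduction in any number of steps. **Equality in $\lambda\omega$.** $=_\omega$ is the least relation between closed terms that contains $\beta\eta$-conversion, is symmetric and transitive, satisfies $M=_\omega N\Rightarrow PM=_\omega PN$, and is closed under the $\omega$-rule: if $PR=_\omega QR$ for every closed $R$, then $P=_\omega Q$. **Proofs.** A proof of $F=_\omega F'$ is a well-founded tree which either - ends in an instance of the $\omega$-rule, with a proof of $FR=_\omega F'R$ for every closed $R$; or - ends in an endpiece, i.e. for some $t\ge 0$ a chain $$F\twoheadrightarrow_{\beta\eta}H_1\twoheadleftarrow_{\beta\eta}G_1M_1=_\omega G_1N_1\twoheadrightarrow_{\beta\eta}H_2\twoheadleftarrow_{\beta\eta}\cdots\; G_tM_t=_\omega G_tN_t\twoheadrightarrow_{\beta\eta}H_{t+1}\twoheadleftarrow_{\beta\eta}F'$$ whose leaves $M_i=_\omega N_i$ $(1\le i\le t)$ are direct conclusions of the $\omega$-rule, with proofs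 of all the premises. For $t=0$ this is a single $\beta\eta$-conversion $F\twoheadrightarrow_{\beta\eta}H_1\twoheadleftarrow_{\beta\eta}F'$. **Supercofinal sets.** A zero-term is a term that does not $\beta$-reduce to an abstraction. A set $\mathcal X$ of closed terms is *supercofinal* if every closed term has a $\beta\eta$-reduct in $\mathcal X$ and $\mathcal X$ contains every closed term that does not $\beta\eta$-reduce to a zero-term. **Canonical proofs.** Let $\mathcal X$ be supercofinal. A proof ending in the $\omega$-rule is *$\mathcal X$-canonical* if the proofs of all its premises are. A proof ending in an endpiece as above is *$\mathcal X$-canonical* if the proofs of all the premises of its leaves are $\mathcal X$-canonical, all confluence terms $H_1,\dots,H_{t+1}$ belong to $\mathcal X$, and for every $i$ with $1\le i\le t$ there are $m,n\ge 0$ and terms $Y,L_1,\dots,L_m,Z_1,\dots,Z_n$ with $$G_i\equiv\lambda x.\,\lambda y_1\dots y_n.\,((\lambda y.Y)L_1\cdots L_m)Z_1\cdots Z_n$$ such that: - (left) $G_iM_i\twoheadrightarrow_{\beta\eta}H_i$ by a reduction consisting of the one $\beta$-step to $[M_i/x](\lambda y_1\dots y_n.((\lambda y.Y)L_1\cdots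 L_m)Z_1\cdots Z_n)$, followed by contractions of $\beta$-redexes other than the head redex, followed by $\eta$-steps; - (right) $G_iN_i\twoheadrightarrow_{\beta\eta}H_{i+1}$ by a reduction of the form $$\begin{aligned}G_iN_i&\twoheadrightarrow_{\beta\eta}[N_i/x](\lambda y_1\dots y_n.((\lambda y.Y)L_1\cdots L_m)Z_1\cdots Z_n)\\&\twoheadrightarrow_{\beta\eta}\lambda y_1\dots y_n.\,([N_i/x](\lambda y.Y)\,[N_i/x]L_1\cdots[N_i/x]L_m)\,y_1\cdots y_n\\&\twoheadrightarrow_{\eta}[N_i/x](\lambda y.Y)\,[N_i/x]L_1\cdots[N_i/x]L_m\twoheadrightarrow_{\beta\eta}J_0J_1\cdots J_m\twoheadrightarrow_{\beta\eta}H_{i+1},\end{aligned}$$ where $J_0$ is the $\beta\eta$-normal form of $[N_i/x](\lambda y.Y)$ if it exists and $[N_i/x](\lambda y.Y)$ itself otherwise, and $J_k$ $(1\le k\le m)$ is obtained from $[N_i/x]L_k$ in the same way. **Proposition.** For every supercofinal set $\mathcal X$ and all closed terms $M,N$: if $M=_\omega N$, then there is an $\mathcal X$-canonical proof of $M=_\omega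 N$. -/

import Mathlib

open Relation

namespace LambdaOmega

/-- Pure untyped `λ`-terms up to renaming of bound variables (well-scoped de Bruijn terms):
`Term n` consists of the terms whose free variables are among `n` given ones, where the variable
`0` is the one bound innermost. `Term 0` is the set of closed terms. -/
inductive Term : ℕ → Type
  | var {n : ℕ} (i : Fin n) : Term n
  | app {n : ℕ} (s t : Term n) : Term n
  | lam {n : ℕ} (t : Term (n + 1)) : Term n

namespace Term

/-- Renaming of free variables. -/
def rename : {m n : ℕ} → (Fin m → Fin n) → Term m → Term n
  | _, _, f, var i => var (f i)
  | _, _, f, app s t => app (rename f s) (rename f t)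
  | _, _, f, lam t => lam (rename (Fin.cases 0 fun i => (f i).succ) t)

/-- Simultaneous capture-avoiding substitution. -/
def subst : {m n : ℕ} → (Fin m → Term n) → Term m → Term n
  | _, _, f, var i => f i
  | _, _, f, app s t => app (subst f s) (subst f t)
  | _, _, f, lam t => lam (subst (Fin.cases (var 0) fun i => rename Fin.succ (f i)) t)

/-- `inst t u` is `[u/x]t`, where `x` is the variable `0` of `t`. -/
def inst {n : ℕ} (t : Term (n + 1)) (u : Term n) : Term n :=
  subst (Fin.cases u var) t

/-- `apps s [t₁, …, tₘ]` is `s t₁ ⋯ tₘ`. -/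
def apps {n : ℕ} (s : Term n) (ts : List (Term n)) : Term n :=
  ts.foldl app s

/-- `lams n t` is `λ y₁ … yₙ. t`; in `t` the variable `yⱼ` has index `n - j`, and the `k`
variables of the context have the indices `n, …, n + k - 1`. -/
def lams {k : ℕ} : (n : ℕ) → Term (k + n) → Term k
  | 0, t => t
  | n + 1, t => lams n (lam t)

/-- The term `t`, placed in the scope of `n` further binders (whose variables it does not
contain). -/
def weaken {k : ℕ} (n : ℕ) (t : Term k) : Term (k + n) :=
  rename (fun i => i.addNat n) t

/-- The list `y₁, …, yₙ` of the variables bound by `lams n`. -/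
def boundVars (k n : ℕ) : List (Term (k + n)) :=
  List.ofFn fun j : Fin n => var ((Fin.rev j).castLE (Nat.le_add_left n k))

end Term

open Term

/-- One-step `β`-reduction. -/
inductive Beta : {n : ℕ} → Term n → Term n → Prop
  | beta {n : ℕ} (t : Term (n + 1)) (u : Term n) : Beta (app (lam t) u) (inst t u)
  | appL {n : ℕ} {s s' : Term n} (t : Term n) : Beta s s' → Beta (app s t) (app s' t)
  | appR {n : ℕ} (s : Term n) {t t' : Term n} : Beta t t' → Beta (app s t) (app s t')
  | lam {n : ℕ} {t t' : Term (n + 1)} : Beta t t' → Beta (lam t) (lam t')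

/-- One-step `η`-reduction. -/
inductive Eta : {n : ℕ} → Term n → Term n → Prop
  | eta {n : ℕ} (t : Term n) : Eta (lam (app (rename Fin.succ t) (var 0))) t
  | appL {n : ℕ} {s s' : Term n} (t : Term n) : Eta s s' → Eta (app s t) (app s' t)
  | appR {n : ℕ} (s : Term n) {t t' : Term n} : Eta t t' → Eta (app s t) (app s t')
  | lam {n : ℕ} {t t' : Term (n + 1)} : Eta t t' → Eta (lam t) (lam t')

/-- One-step `βη`-reduction. -/
def BetaEta {n : ℕ} (s t : Term n) : Prop := Beta s t ∨ Eta s t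

/-- Contraction of a `β`-redex other than the head redex. The head redex of a term
`λ y₁ … yₙ. (λ y. A) B C₁ ⋯ Cₘ` is `(λ y. A) B`; terms of any other shape have none. -/
inductive NonHeadBeta : {n : ℕ} → Term n → Term n → Prop
  | lam {n : ℕ} {t t' : Term (n + 1)} : NonHeadBeta t t' → NonHeadBeta (lam t) (lam t')
  | appR {n : ℕ} (s : Term n) {t t' : Term n} : Beta t t' → NonHeadBeta (app s t) (app s t')
  | appLam {n : ℕ} {s s' : Term (n + 1)} (t : Term n) :
      Beta s s' → NonHeadBeta (app (lam s) t) (app (lam s') t)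
  | appL {n : ℕ} {s s' : Term n} (t : Term n) :
      NonHeadBeta s s' → NonHeadBeta (app s t) (app s' t)

/-- `β`-reduction in any number of steps. -/
def BetaRed {n : ℕ} (s t : Term n) : Prop := ReflTransGen Beta s t

/-- `η`-reduction in any number of steps. -/
def EtaRed {n : ℕ} (s t : Term n) : Prop := ReflTransGen Eta s t

/-- `βη`-reduction in any number of steps. -/
def BetaEtaRed {n : ℕ} (s t : Term n) : Prop := ReflTransGen BetaEta s t

/-- Any number of non-head `β`-reduction steps. -/
def NonHeadRed {n : ℕ} (s t : Term n) : Prop := ReflTransGen NonHeadBeta s t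

/-- `βη`-conversion. -/
def BetaEtaConv {n : ℕ} (s t : Term n) : Prop := EqvGen BetaEta s t

/-- `βη`-normal forms. -/
def IsNormal {n : ℕ} (t : Term n) : Prop := ∀ t', ¬ BetaEta t t'

/-- Equality in `λω`, between closed terms. -/
inductive OmegaEq : Term 0 → Term 0 → Prop
  | conv {M N : Term 0} : BetaEtaConv M N → OmegaEq M N
  | app (P : Term 0) {M N : Term 0} : OmegaEq M N → OmegaEq (app P M) (app P N)
  | symm {M N : Term 0} : OmegaEq M N → OmegaEq N M
  | trans {M N P : Term 0} : OmegaEq M N → OmegaEq N P → OmegaEq M P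
  | omega {P Q : Term 0} : (∀ R : Term 0, OmegaEq (Term.app P R) (Term.app Q R)) → OmegaEq P Q

/-- Proofs in `λω`, as well-founded trees whose endpieces are in standard form. A proof of
`F = F'` either ends in an instance of the `ω`-rule, or it ends in an endpiece
`F ↠ H₀ ↞ G₀ M₀ = G₀ N₀ ↠ H₁ ↞ G₁ M₁ = G₁ N₁ ↠ ⋯ ↠ H_t ↞ F'` (with `βη`-reductions), in which
each of the `t` equations `Mᵢ = Nᵢ` is a direct conclusion of the `ω`-rule, with the premises
`Mᵢ R = Nᵢ R` proved by the trees `leaf i R`. For `t = 0` the endpiece is a single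
`βη`-conversion `F ↠ H₀ ↞ F'`. -/
inductive ProofTree : Term 0 → Term 0 → Type
  | omega {P Q : Term 0} (prem : ∀ R : Term 0, ProofTree (app P R) (app Q R)) : ProofTree P Q
  | endpiece {F F' : Term 0} (t : ℕ) (G M N : Fin t → Term 0) (H : Fin (t + 1) → Term 0)
      (first : BetaEtaRed F (H 0))
      (left : ∀ i : Fin t, BetaEtaRed (app (G i) (M i)) (H i.castSucc))
      (right : ∀ i : Fin t, BetaEtaRed (app (G i) (N i)) (H i.succ))
      (last : BetaEtaRed F' (H (Fin.last t)))
      (leaf : ∀ (i : Fin t) (R : Term 0), ProofTree (app (M i) R) (app (N i) R)) :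
      ProofTree F F'

/-- Zero-terms, i.e. (closed) terms of order `0`: those that do not reduce to an abstraction. -/
def IsZeroTerm (M : Term 0) : Prop := ∀ P : Term 1, ¬ BetaRed M (lam P)

/-- Cofinality for `βη`-reduction. -/
def Cofinal (X : Set (Term 0)) : Prop := ∀ M : Term 0, ∃ H ∈ X, BetaEtaRed M H

/-- Supercofinal sets of closed terms. -/
def Supercofinal (X : Set (Term 0)) : Prop :=
  Cofinal X ∧ ∀ M : Term 0, (¬ ∃ Z : Term 0, IsZeroTerm Z ∧ BetaEtaRed M Z) → M ∈ X

/-- `J` is the `βη`-normal form of `A`, if there is one, and `A` itself otherwise. -/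
def IsNormalFormOrSelf {n : ℕ} (A J : Term n) : Prop :=
  (BetaEtaRed A J ∧ IsNormal J) ∨ ((¬ ∃ K, BetaEtaRed A K ∧ IsNormal K) ∧ J = A)

/-- The term `(λ y. Y) L₁ ⋯ Lₘ`, whose only free variable is `x`. -/
def headPart (Y : Term 2) (L : List (Term 1)) : Term 1 := apps (lam Y) L

/-- The term `λ y₁ … yₙ. ((λ y. Y) L₁ ⋯ Lₘ) Z₁ ⋯ Zₙ`, whose only free variable is `x`. The `Zⱼ`
may contain `x, y₁, …, yₙ`; the terms `λ y. Y` and `Lₖ` contain at most `x`, which is what makes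
the `η`-steps in `RightStructure` possible, the term substituted for `x` being closed. -/
def leafBody (Y : Term 2) (L : List (Term 1)) {n : ℕ} (Z : Fin n → Term (1 + n)) : Term 1 :=
  lams n (apps (weaken n (headPart Y L)) (List.ofFn Z))

/-- The term `λ y₁ … yₙ. ((λ y. Y) L₁ ⋯ Lₘ) y₁ ⋯ yₙ`. -/
def leafBodyEta (Y : Term 2) (L : List (Term 1)) (n : ℕ) : Term 1 :=
  lams n (apps (weaken n (headPart Y L)) (boundVars 1 n))

/-- A left reduction `(λ x. B) M ↠ H` that consists of the step to `[M/x]B`, followed by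
non-head `β`-reductions, followed by `η`-reductions. -/
def LeftStructure (B : Term 1) (M H : Term 0) : Prop :=
  ∃ K : Term 0, NonHeadRed (inst B M) K ∧ EtaRed K H

/-- A right reduction of the shape
`G N ↠ [N/x](λ y₁ … yₙ. ((λ y. Y) L₁ ⋯ Lₘ) Z₁ ⋯ Zₙ)`
`↠ λ y₁ … yₙ. ([N/x](λ y. Y) [N/x]L₁ ⋯ [N/x]Lₘ) y₁ ⋯ yₙ`
`↠ [N/x](λ y. Y) [N/x]L₁ ⋯ [N/x]Lₘ` (by `η`-steps) `↠ J₀ J₁ ⋯ Jₘ ↠ H`. -/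
def RightStructure (Y : Term 2) (L : List (Term 1)) {n : ℕ} (Z : Fin n → Term (1 + n))
    (N H : Term 0) : Prop :=
  BetaEtaRed (app (lam (leafBody Y L Z)) N) (inst (leafBody Y L Z) N) ∧
  BetaEtaRed (inst (leafBody Y L Z) N) (inst (leafBodyEta Y L n) N) ∧
  EtaRed (inst (leafBodyEta Y L n) N) (inst (headPart Y L) N) ∧
  ∃ (J₀ : Term 0) (J : List (Term 0)),
    IsNormalFormOrSelf (inst (lam Y) N) J₀ ∧
    List.Forall₂ (fun l j => IsNormalFormOrSelf (inst l N) j) L J ∧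
    BetaEtaRed (inst (headPart Y L) N) (apps J₀ J) ∧
    BetaEtaRed (apps J₀ J) H

/-- The conditions on a component `H ↞ G M = G N ↠ H'` of a canonical endpiece. -/
def CanonicalComponent (G M N H H' : Term 0) : Prop :=
  ∃ (Y : Term 2) (L : List (Term 1)) (n : ℕ) (Z : Fin n → Term (1 + n)),
    G = lam (leafBody Y L Z) ∧
    LeftStructure (leafBody Y L Z) M H ∧
    RightStructure Y L Z N H'

/-- `X`-canonical proofs. -/
def ProofTree.IsCanonical (X : Set (Term 0)) : {F F' : Term 0} → ProofTree F F' → Prop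
  | _, _, .omega prem => ∀ R, (prem R).IsCanonical X
  | _, _, .endpiece _ G M N H _ _ _ _ leaf =>
      (∀ i, H i ∈ X) ∧
      (∀ i, CanonicalComponent (G i) (M i) (N i) (H i.castSucc) (H i.succ)) ∧
      ∀ i R, (leaf i R).IsCanonical X

end LambdaOmega

namespace LambdaOmega

theorem map_red {α β : Type*} {r : α → α → Prop} {p : β → β → Prop} (f : α → β)
    (h : ∀ a b, r a b → p (f a) (f b)) {a b : α} (hab : ReflTransGen r a b) :
    ReflTransGen p (f a) (f b) := by
  induction hab with
  | refl => exact .refl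
  | tail _ hbc ih => exact ih.tail (h _ _ hbc)

theorem mono_red {α : Type*} {r p : α → α → Prop} (h : ∀ a b, r a b → p a b) {a b : α}
    (hab : ReflTransGen r a b) : ReflTransGen p a b := map_red id h hab

namespace Term

/-- The lifting of a renaming under a binder. -/
def upr {m n : ℕ} (f : Fin m → Fin n) : Fin (m + 1) → Fin (n + 1) :=
  Fin.cases 0 fun i => (f i).succ

/-- The lifting of a substitution under a binder. -/
def up {m n : ℕ} (σ : Fin m → Term n) : Fin (m + 1) → Term (n + 1) :=
  Fin.cases (var 0) fun i => rename Fin.succ (σ i)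

/-- The substitution of a term for the variable `0`. -/
def single {n : ℕ} (u : Term n) : Fin (n + 1) → Term n := Fin.cases u var

section
variable {k m n : ℕ}

@[simp] theorem upr_zero (f : Fin m → Fin n) : upr f 0 = 0 := rfl
@[simp] theorem upr_succ (f : Fin m → Fin n) (i : Fin m) : upr f i.succ = (f i).succ := rfl
@[simp] theorem up_zero (σ : Fin m → Term n) : up σ 0 = var 0 := rfl
@[simp] theorem up_succ (σ : Fin m → Term n) (i : Fin m) :
    up σ i.succ = rename Fin.succ (σ i) := rfl
@[simp] theorem single_zero (u : Term n) : single u 0 = u := rfl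
@[simp] theorem single_succ (u : Term n) (i : Fin n) : single u i.succ = var i := rfl

@[simp] theorem rename_var (f : Fin m → Fin n) (i : Fin m) : rename f (var i) = var (f i) := rfl
@[simp] theorem rename_app (f : Fin m → Fin n) (s t : Term m) :
    rename f (app s t) = app (rename f s) (rename f t) := rfl
@[simp] theorem rename_lam (f : Fin m → Fin n) (t : Term (m + 1)) :
    rename f (lam t) = lam (rename (upr f) t) := rfl
@[simp] theorem subst_var (σ : Fin m → Term n) (i : Fin m) : subst σ (var i) = σ i := rfl
@[simp] theorem subst_app (σ : Fin m → Term n) (s t : Term m) :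
    subst σ (app s t) = app (subst σ s) (subst σ t) := rfl
@[simp] theorem subst_lam (σ : Fin m → Term n) (t : Term (m + 1)) :
    subst σ (lam t) = lam (subst (up σ) t) := rfl

theorem inst_eq (t : Term (n + 1)) (u : Term n) : inst t u = subst (single u) t := rfl

theorem rename_rename (t : Term k) : ∀ {m n : ℕ} (f : Fin k → Fin m) (g : Fin m → Fin n),
    rename g (rename f t) = rename (g ∘ f) t := by
  induction t with
  | var i => intros; rfl
  | app s t ihs iht => intro m n f g; simp [ihs, iht]
  | lam t ih =>
    intro m n f g
    simp only [rename_lam, ih]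
    congr 2
    funext i
    cases i using Fin.cases <;> rfl

theorem subst_rename (t : Term k) : ∀ {m n : ℕ} (f : Fin k → Fin m) (σ : Fin m → Term n),
    subst σ (rename f t) = subst (σ ∘ f) t := by
  induction t with
  | var i => intros; rfl
  | app s t ihs iht => intro m n f g; simp [ihs, iht]
  | lam t ih =>
    intro m n f g
    simp only [rename_lam, subst_lam, ih]
    congr 2
    funext i
    cases i using Fin.cases <;> rfl

theorem rename_subst (t : Term k) : ∀ {m n : ℕ} (σ : Fin k → Term m) (f : Fin m → Fin n),
    rename f (subst σ t) = subst (fun i => rename f (σ i)) t := by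
  induction t with
  | var i => intros; rfl
  | app s t ihs iht => intro m n f g; simp [ihs, iht]
  | lam t ih =>
    intro m n f g
    simp only [rename_lam, subst_lam, ih]
    congr 2
    funext i
    cases i using Fin.cases with
    | zero => rfl
    | succ i => simp only [up_succ, rename_rename]; rfl

theorem subst_subst (t : Term k) : ∀ {m n : ℕ} (σ : Fin k → Term m) (τ : Fin m → Term n),
    subst τ (subst σ t) = subst (fun i => subst τ (σ i)) t := by
  induction t with
  | var i => intros; rfl
  | app s t ihs iht => intro m n f g; simp [ihs, iht]
  | lam t ih =>
    intro m n f g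
    simp only [subst_lam, ih]
    congr 2
    funext i
    cases i using Fin.cases with
    | zero => rfl
    | succ i => simp only [up_succ, subst_rename, rename_subst]; rfl

theorem up_var : up (var : Fin n → Term n) = var := by
  funext i
  cases i using Fin.cases <;> rfl

theorem subst_id (t : Term n) : subst var t = t := by
  induction t with
  | var i => rfl
  | app s t ihs iht => simp [ihs, iht]
  | lam t ih => rw [subst_lam, up_var, ih]

theorem up_var_comp (f : Fin m → Fin n) : up (fun i => var (f i)) = fun i => var (upr f i) := by
  funext i
  cases i using Fin.cases <;> rfl

theorem rename_eq_subst (f : Fin m → Fin n) (t : Term m) :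
    rename f t = subst (fun i => var (f i)) t := by
  induction t generalizing n with
  | var i => rfl
  | app s t ihs iht => simp [ihs, iht]
  | lam t ih => rw [rename_lam, subst_lam, up_var_comp, ih]

theorem rename_id (t : Term n) : rename (fun i => i) t = t := by
  rw [rename_eq_subst, subst_id]

@[simp] theorem inst_rename_succ (t : Term n) (u : Term n) : inst (rename Fin.succ t) u = t := by
  rw [inst_eq, subst_rename]
  exact subst_id t

@[simp] theorem inst_var_zero (u : Term n) : inst (var 0) u = u := rfl
@[simp] theorem inst_app (s t : Term (n + 1)) (u : Term n) :
    inst (app s t) u = app (inst s u) (inst t u) := rfl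

theorem subst_up_rename_succ (σ : Fin m → Term n) (t : Term m) :
    subst (up σ) (rename Fin.succ t) = rename Fin.succ (subst σ t) := by
  rw [subst_rename, rename_subst]; rfl

theorem rename_upr_rename_succ (f : Fin m → Fin n) (t : Term m) :
    rename (upr f) (rename Fin.succ t) = rename Fin.succ (rename f t) := by
  rw [rename_rename, rename_rename]; rfl

theorem subst_inst (σ : Fin m → Term n) (t : Term (m + 1)) (u : Term m) :
    subst σ (inst t u) = inst (subst (up σ) t) (subst σ u) := by
  simp only [inst_eq, subst_subst]
  congr 1
  funext i
  cases i using Fin.cases with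
  | zero => rfl
  | succ i =>
    simp only [single_succ, subst_var, up_succ, subst_rename]
    exact (subst_id _).symm

theorem rename_inst (f : Fin m → Fin n) (t : Term (m + 1)) (u : Term m) :
    rename f (inst t u) = inst (rename (upr f) t) (rename f u) := by
  simp only [rename_eq_subst, subst_inst, up_var_comp]

@[simp] theorem inst_rename_upr_succ (t : Term (n + 1)) :
    inst (rename (upr Fin.succ) t) (var 0) = t := by
  rw [inst_eq, subst_rename]
  convert subst_id t using 2
  funext i
  cases i using Fin.cases <;> rfl

theorem rename_injective {f : Fin m → Fin n} (hf : Function.Injective f) :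
    Function.Injective (rename f) := by
  intro s t h
  induction s generalizing n with
  | var i => cases t <;> simp_all [hf.eq_iff]
  | app s₁ s₂ ih₁ ih₂ =>
    cases t with
    | app t₁ t₂ =>
      simp only [rename_app, app.injEq] at h
      rw [ih₁ hf h.1, ih₂ hf h.2]
    | _ => simp at h
  | lam s ih =>
    cases t with
    | lam t =>
      simp only [rename_lam, lam.injEq] at h
      rw [ih (fun i j hij => ?_) h]
      cases i using Fin.cases <;> cases j using Fin.cases <;>
        simp_all [hf.eq_iff, Fin.succ_ne_zero, (Fin.succ_ne_zero _).symm]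
    | _ => simp at h

/-- The closed term `t`, as a term with free variables. -/
def emb (t : Term 0) : Term n := rename Fin.elim0 t

@[simp] theorem emb_zero (t : Term 0) : (emb t : Term 0) = t := by
  rw [emb, show (Fin.elim0 : Fin 0 → Fin 0) = fun i => i from funext fun i => i.elim0, rename_id]

@[simp] theorem subst_emb (σ : Fin m → Term n) (t : Term 0) : subst σ (emb t) = emb t := by
  rw [emb, emb, subst_rename, rename_eq_subst]
  congr 1
  funext i
  exact i.elim0

@[simp] theorem rename_emb (f : Fin m → Fin n) (t : Term 0) : rename f (emb t) = emb t := by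
  rw [rename_eq_subst, subst_emb]

@[simp] theorem inst_emb (u : Term n) (t : Term 0) : inst (emb t) u = emb t := subst_emb _ _

theorem subst_apps (σ : Fin m → Term n) (s : Term m) (ts : List (Term m)) :
    subst σ (apps s ts) = apps (subst σ s) (ts.map (subst σ)) := by
  induction ts generalizing s with
  | nil => rfl
  | cons t ts ih => exact ih (app s t)

theorem apps_append_singleton (s : Term n) (ts : List (Term n)) (t : Term n) :
    apps s (ts ++ [t]) = app (apps s ts) t := by
  simp [apps]

end

end Term

open Term

section
variable {m n : ℕ}

theorem Beta.subst {s t : Term m} (h : Beta s t) :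
    ∀ {n : ℕ} (σ : Fin m → Term n), Beta (subst σ s) (subst σ t) := by
  induction h with
  | beta t u => intro n σ; rw [subst_inst]; exact .beta _ _
  | appL t _ ih => intro n σ; exact .appL _ (ih σ)
  | appR s _ ih => intro n σ; exact .appR _ (ih σ)
  | lam _ ih => intro n σ; exact .lam (ih _)

theorem Eta.subst {s t : Term m} (h : Eta s t) :
    ∀ {n : ℕ} (σ : Fin m → Term n), Eta (subst σ s) (subst σ t) := by
  induction h with
  | eta t =>
    intro n σ
    simp only [subst_lam, subst_app, subst_up_rename_succ, subst_var, up_zero]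
    exact .eta _
  | appL t _ ih => intro n σ; exact .appL _ (ih σ)
  | appR s _ ih => intro n σ; exact .appR _ (ih σ)
  | lam _ ih => intro n σ; exact .lam (ih _)

theorem BetaEta.subst {s t : Term m} (h : BetaEta s t) (σ : Fin m → Term n) :
    BetaEta (subst σ s) (subst σ t) := h.imp (·.subst σ) (·.subst σ)

theorem BetaEta.rename {s t : Term m} (h : BetaEta s t) (f : Fin m → Fin n) :
    BetaEta (rename f s) (rename f t) := by
  simpa only [rename_eq_subst] using h.subst _

theorem BetaEta.appL {s s' : Term n} (h : BetaEta s s') (t : Term n) :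
    BetaEta (app s t) (app s' t) := h.imp (.appL t) (.appL t)

theorem BetaEta.appR {t t' : Term n} (s : Term n) (h : BetaEta t t') :
    BetaEta (app s t) (app s t') := h.imp (.appR s) (.appR s)

theorem BetaEta.lam {t t' : Term (n + 1)} (h : BetaEta t t') :
    BetaEta (lam t) (lam t') := h.imp .lam .lam

theorem BetaRed.app {s s' t t' : Term n} (h : BetaRed s s') (h' : BetaRed t t') :
    BetaRed (app s t) (app s' t') :=
  (map_red (Term.app · t) (fun _ _ => .appL t) h).trans
    (map_red (Term.app s') (fun _ _ => .appR s') h')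

theorem BetaRed.lam {t t' : Term (n + 1)} (h : BetaRed t t') : BetaRed (lam t) (lam t') :=
  map_red Term.lam (fun _ _ => .lam) h

theorem EtaRed.app {s s' t t' : Term n} (h : EtaRed s s') (h' : EtaRed t t') :
    EtaRed (app s t) (app s' t') :=
  (map_red (Term.app · t) (fun _ _ => .appL t) h).trans
    (map_red (Term.app s') (fun _ _ => .appR s') h')

theorem EtaRed.lam {t t' : Term (n + 1)} (h : EtaRed t t') : EtaRed (lam t) (lam t') :=
  map_red Term.lam (fun _ _ => .lam) h

theorem BetaRed.betaEtaRed {s t : Term n} (h : BetaRed s t) : BetaEtaRed s t :=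
  mono_red (fun _ _ => Or.inl) h

theorem EtaRed.betaEtaRed {s t : Term n} (h : EtaRed s t) : BetaEtaRed s t :=
  mono_red (fun _ _ => Or.inr) h

theorem BetaEtaRed.refl (t : Term n) : BetaEtaRed t t := ReflTransGen.refl

theorem BetaEtaRed.trans {s t u : Term n} (h : BetaEtaRed s t) (h' : BetaEtaRed t u) :
    BetaEtaRed s u := ReflTransGen.trans h h'

theorem BetaEtaRed.app {s s' t t' : Term n} (h : BetaEtaRed s s') (h' : BetaEtaRed t t') :
    BetaEtaRed (app s t) (app s' t') :=
  (map_red (Term.app · t) (fun _ _ h => h.appL t) h).trans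
    (map_red (Term.app s') (fun _ _ h => h.appR s') h')

theorem BetaEtaRed.subst {s t : Term m} (h : BetaEtaRed s t) (σ : Fin m → Term n) :
    BetaEtaRed (subst σ s) (subst σ t) :=
  map_red (Term.subst σ) (fun _ _ h => h.subst σ) h

/-- One step of weak head reduction. -/
inductive Wh : {n : ℕ} → Term n → Term n → Prop
  | beta {n : ℕ} (t : Term (n + 1)) (u : Term n) : Wh (app (lam t) u) (inst t u)
  | appL {n : ℕ} {s s' : Term n} (t : Term n) : Wh s s' → Wh (app s t) (app s' t)

/-- Weak head reduction in any number of steps. -/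
def WhRed (s t : Term n) : Prop := ReflTransGen Wh s t

theorem Wh.toBeta {s t : Term n} (h : Wh s t) : Beta s t := by
  induction h with
  | beta t u => exact .beta t u
  | appL t _ ih => exact .appL t ih

theorem Wh.subst {s t : Term m} (h : Wh s t) (σ : Fin m → Term n) :
    Wh (subst σ s) (subst σ t) := by
  induction h with
  | beta t u => rw [subst_inst]; exact .beta _ _
  | appL t _ ih => exact .appL _ ih

theorem WhRed.betaRed {s t : Term n} (h : WhRed s t) : BetaRed s t :=
  mono_red (fun _ _ => Wh.toBeta) h

theorem WhRed.subst {s t : Term m} (h : WhRed s t) (σ : Fin m → Term n) :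
    WhRed (subst σ s) (subst σ t) :=
  map_red (Term.subst σ) (fun _ _ h => h.subst σ) h

theorem WhRed.appL {s s' : Term n} (h : WhRed s s') (t : Term n) : WhRed (app s t) (app s' t) :=
  map_red (Term.app · t) (fun _ _ => .appL t) h

/-- Standard `βη`-reductions: weak head reduction followed by standard reductions of the
immediate subterms, where an abstraction may be contracted by a final `η`-step. -/
inductive Standard : {n : ℕ} → Term n → Term n → Prop
  | var {n : ℕ} {a : Term n} {i : Fin n} : WhRed a (var i) → Standard a (var i)
  | lam {n : ℕ} {a : Term n} {b t : Term (n + 1)} :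
      WhRed a (lam b) → Standard b t → Standard a (lam t)
  | app {n : ℕ} {a b c s t : Term n} :
      WhRed a (app b c) → Standard b s → Standard c t → Standard a (app s t)
  | eta {n : ℕ} {a t : Term n} {b : Term (n + 1)} :
      WhRed a (lam b) → Standard b (app (rename Fin.succ t) (.var 0)) → Standard a t

namespace Standard

theorem refl (t : Term n) : Standard t t := by
  induction t with
  | var i => exact .var .refl
  | app s t ihs iht => exact .app .refl ihs iht
  | lam t ih => exact .lam .refl ih

theorem head {a b t : Term n} (h : WhRed a b) (h' : Standard b t) : Standard a t := by
  cases h' with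
  | var h₁ => exact .var (h.trans h₁)
  | lam h₁ h₂ => exact .lam (h.trans h₁) h₂
  | app h₁ h₂ h₃ => exact .app (h.trans h₁) h₂ h₃
  | eta h₁ h₂ => exact .eta (h.trans h₁) h₂

theorem rename {a t : Term m} (h : Standard a t) :
    ∀ {n : ℕ} (f : Fin m → Fin n), Standard (rename f a) (rename f t) := by
  have key : ∀ {m n : ℕ} {a b : Term m} (f : Fin m → Fin n), WhRed a b →
      WhRed (Term.rename f a) (Term.rename f b) := fun f h => by
    simpa only [rename_eq_subst] using h.subst _
  induction h with
  | var h => intro n f; exact .var (key f h)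
  | lam h _ ih => intro n f; exact .lam (key f h) (ih _)
  | app h _ _ ih₁ ih₂ => intro n f; exact .app (key f h) (ih₁ f) (ih₂ f)
  | eta h _ ih =>
    intro n f
    refine .eta (key f h) ?_
    have := ih (upr f)
    rwa [rename_app, rename_upr_rename_succ] at this

theorem subst {a t : Term m} (h : Standard a t) :
    ∀ {n : ℕ} {σ τ : Fin m → Term n}, (∀ i, Standard (σ i) (τ i)) →
      Standard (subst σ a) (subst τ t) := by
  have hup : ∀ {m n : ℕ} {σ τ : Fin m → Term n}, (∀ i, Standard (σ i) (τ i)) →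
      ∀ i, Standard (up σ i) (up τ i) := by
    intro m n σ τ h i
    cases i using Fin.cases with
    | zero => exact refl _
    | succ i => exact (h i).rename _
  induction h with
  | var h => intro n σ τ hs; exact (hs _).head (h.subst σ)
  | lam h _ ih => intro n σ τ hs; exact .lam (h.subst σ) (ih (hup hs))
  | app h _ _ ih₁ ih₂ => intro n σ τ hs; exact .app (h.subst σ) (ih₁ hs) (ih₂ hs)
  | eta h _ ih =>
    intro n σ τ hs
    refine .eta (h.subst σ) ?_
    have := ih (hup hs)
    rwa [subst_app, subst_up_rename_succ] at this

theorem inst {a t : Term (n + 1)} {b u : Term n} (h : Standard a t) (h' : Standard b u) :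
    Standard (inst a b) (inst t u) := by
  refine h.subst fun i => ?_
  cases i using Fin.cases with
  | zero => exact h'
  | succ i => exact refl _

theorem step_and_lam_inv {a t : Term n} (h : Standard a t) :
    (∀ t', BetaEta t t' → Standard a t') ∧
      ∀ t₀, t = .lam t₀ → ∃ b, WhRed a (.lam b) ∧ Standard b t₀ := by
  induction h with
  | var h =>
    refine ⟨fun t' ht => ?_, fun _ h => by cases h⟩
    rcases ht with ht | ht <;> cases ht
  | lam h hs ih =>
    refine ⟨fun t' ht => ?_, fun t₀ e => by cases e; exact ⟨_, h, hs⟩⟩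
    rcases ht with ht | ht
    · cases ht with
      | lam ht => exact .lam h (ih.1 _ (.inl ht))
    · cases ht with
      | lam ht => exact .lam h (ih.1 _ (.inr ht))
      | eta t => exact .eta h hs
  | app h hs₁ hs₂ ih₁ ih₂ =>
    refine ⟨fun t' ht => ?_, fun _ h => by cases h⟩
    rcases ht with ht | ht
    · cases ht with
      | beta t u =>
        obtain ⟨b, hb, hbt⟩ := ih₁.2 _ rfl
        exact (hbt.inst hs₂).head ((h.trans (hb.appL _)).tail (.beta _ _))
      | appL _ ht => exact .app h (ih₁.1 _ (.inl ht)) hs₂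
      | appR _ ht => exact .app h hs₁ (ih₂.1 _ (.inl ht))
    · cases ht with
      | appL _ ht => exact .app h (ih₁.1 _ (.inr ht)) hs₂
      | appR _ ht => exact .app h hs₁ (ih₂.1 _ (.inr ht))
  | eta h hs ih =>
    refine ⟨fun t' ht => .eta h (ih.1 _ ((ht.rename _).appL _)), fun t₀ e => ?_⟩
    subst e
    refine ⟨_, h, ih.1 _ (.inl ?_)⟩
    simpa using Beta.beta (Term.rename (upr Fin.succ) t₀) (.var 0)

end Standard

theorem BetaEtaRed.standard {s t : Term n} (h : BetaEtaRed s t) : Standard s t := by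
  induction h with
  | refl => exact .refl s
  | tail _ h ih => exact ih.step_and_lam_inv.1 _ h

theorem BetaEtaRed.whRed_lam {s : Term n} {t : Term (n + 1)} (h : BetaEtaRed s (.lam t)) :
    ∃ b, WhRed s (.lam b) :=
  (h.standard.step_and_lam_inv.2 _ rfl).imp fun _ h => h.1

/-- Contraction of a `β`-redex other than the weak head redex. -/
inductive Internal : {n : ℕ} → Term n → Term n → Prop
  | lam {n : ℕ} {t t' : Term (n + 1)} : Beta t t' → Internal (lam t) (lam t')
  | appR {n : ℕ} (s : Term n) {t t' : Term n} : Beta t t' → Internal (app s t) (app s t')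
  | appL {n : ℕ} {s s' : Term n} (t : Term n) : Internal s s' → Internal (app s t) (app s' t)

theorem Internal.toBeta {s t : Term n} (h : Internal s t) : Beta s t := by
  induction h with
  | lam h => exact .lam h
  | appR s h => exact .appR s h
  | appL t _ ih => exact .appL t ih

theorem Standard.factor {s t : Term n} (h : Standard s t) :
    ∃ a b, WhRed s a ∧ ReflTransGen Internal a b ∧ EtaRed b t := by
  have key : ∀ {n : ℕ} {s a b : Term n}, WhRed s a → ReflTransGen Internal a b → BetaRed s b :=
    fun h h' => h.betaRed.trans (mono_red (fun _ _ => Internal.toBeta) h')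
  induction h with
  | var h => exact ⟨_, _, h, .refl, .refl⟩
  | lam h _ ih =>
    obtain ⟨a, b, h₁, h₂, h₃⟩ := ih
    exact ⟨_, _, h, map_red Term.lam (fun _ _ => Internal.lam) (key h₁ h₂), h₃.lam⟩
  | app h _ _ ih₁ ih₂ =>
    obtain ⟨a, b, h₁, h₂, h₃⟩ := ih₁
    obtain ⟨a', b', h₁', h₂', h₃'⟩ := ih₂
    exact ⟨_, _, h.trans (h₁.appL _),
      (map_red (Term.app · _) (fun _ _ => Internal.appL _) h₂).trans
        (map_red (Term.app b) (fun _ _ => Internal.appR _) (key h₁' h₂')), h₃.app h₃'⟩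
  | eta h _ ih =>
    obtain ⟨a, b, h₁, h₂, h₃⟩ := ih
    exact ⟨_, _, h, map_red Term.lam (fun _ _ => Internal.lam) (key h₁ h₂),
      h₃.lam.tail (.eta _)⟩

end

namespace Term

/-- The variable `i` occurs free in the given term. -/
def Free : {n : ℕ} → Fin n → Term n → Prop
  | _, i, var j => i = j
  | _, i, app s t => Free i s ∨ Free i t
  | _, i, lam t => Free i.succ t

section
variable {m n : ℕ}

theorem exists_rename_of_free (t : Term n) : ∀ {m : ℕ} (f : Fin m → Fin n),
    (∀ i, Free i t → ∃ j, f j = i) → ∃ s, t = rename f s := by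
  induction t with
  | var i =>
    intro m f h
    obtain ⟨j, rfl⟩ := h i rfl
    exact ⟨var j, rfl⟩
  | app s t ihs iht =>
    intro m f h
    obtain ⟨s, rfl⟩ := ihs f fun i hi => h i (.inl hi)
    obtain ⟨t, rfl⟩ := iht f fun i hi => h i (.inr hi)
    exact ⟨app s t, rfl⟩
  | lam t ih =>
    intro m f h
    obtain ⟨t, rfl⟩ := ih (upr f) fun i hi => by
      cases i using Fin.cases with
      | zero => exact ⟨0, rfl⟩
      | succ i =>
        obtain ⟨j, rfl⟩ := h i hi
        exact ⟨j.succ, rfl⟩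
    exact ⟨lam t, rfl⟩

theorem free_rename (t : Term m) : ∀ {n : ℕ} (f : Fin m → Fin n) (j : Fin n),
    Free j (rename f t) ↔ ∃ i, Free i t ∧ f i = j := by
  induction t with
  | var i =>
    intro n f j
    simp [Free, eq_comm]
  | app s t ihs iht =>
    intro n f j
    simp only [rename_app, Free, ihs, iht, or_and_right, exists_or]
  | lam t ih =>
    intro n f j
    simp only [rename_lam, Free, ih]
    constructor
    · rintro ⟨i, hi, hij⟩
      cases i using Fin.cases with
      | zero => simp [(Fin.succ_ne_zero _).symm] at hij
      | succ i => exact ⟨i, hi, by simpa using hij⟩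
    · rintro ⟨i, hi, rfl⟩
      exact ⟨i.succ, hi, rfl⟩

theorem Free.subst {t : Term m} : ∀ {n : ℕ} {σ : Fin m → Term n} {i : Fin m} {j : Fin n},
    Free i t → Free j (σ i) → Free j (subst σ t) := by
  induction t with
  | var k => rintro n σ i j rfl h; exact h
  | app s t ihs iht =>
    rintro n σ i j (h | h) h'
    · exact .inl (ihs h h')
    · exact .inr (iht h h')
  | lam t ih =>
    intro n σ i j h h'
    exact ih (σ := up σ) h ((free_rename _ _ _).2 ⟨j, h', rfl⟩)

theorem eq_var_zero_of_subst_up {σ : Fin m → Term n} {t : Term (m + 1)}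
    (h : subst (up σ) t = var 0) : t = var 0 := by
  cases t with
  | var i =>
    cases i using Fin.cases with
    | zero => rfl
    | succ i =>
      simp only [subst_var, up_succ] at h
      cases hs : σ i <;> simp [hs, Fin.succ_ne_zero] at h
  | app s t => cases h
  | lam t => cases h

theorem exists_of_subst_up_eq_rename {σ : Fin m → Term n} {t : Term (m + 1)} {s : Term n}
    (h : subst (up σ) t = rename Fin.succ s) : ∃ t', t = rename Fin.succ t' ∧ s = subst σ t' := by
  obtain ⟨t, rfl⟩ := exists_rename_of_free t Fin.succ fun i hi => by
    cases i using Fin.cases with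
    | succ i => exact ⟨i, rfl⟩
    | zero =>
      have := hi.subst (σ := up σ) (j := 0) rfl
      rw [h, free_rename] at this
      obtain ⟨i, _, hi⟩ := this
      exact absurd hi (Fin.succ_ne_zero i)
  refine ⟨t, rfl, ?_⟩
  rw [subst_up_rename_succ] at h
  exact (rename_injective (Fin.succ_injective _) h).symm

end

end Term

section
variable {m n : ℕ}

theorem Beta.app_inv {s t u : Term n} (h : Beta (app s t) u) :
    (∃ v, s = .lam v ∧ u = inst v t) ∨ (∃ s', Beta s s' ∧ u = app s' t) ∨
      ∃ t', Beta t t' ∧ u = app s t' := by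
  cases h with
  | beta v _ => exact .inl ⟨v, rfl, rfl⟩
  | appL _ h => exact .inr (.inl ⟨_, h, rfl⟩)
  | appR _ h => exact .inr (.inr ⟨_, h, rfl⟩)

theorem Beta.lam_inv {t : Term (n + 1)} {u : Term n} (h : Beta (.lam t) u) :
    ∃ t', Beta t t' ∧ u = .lam t' := by
  cases h with
  | lam h => exact ⟨_, h, rfl⟩

theorem Eta.app_inv {s t u : Term n} (h : Eta (app s t) u) :
    (∃ s', Eta s s' ∧ u = app s' t) ∨ ∃ t', Eta t t' ∧ u = app s t' := by
  cases h with
  | appL _ h => exact .inl ⟨_, h, rfl⟩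
  | appR _ h => exact .inr ⟨_, h, rfl⟩

theorem Eta.lam_inv {t : Term (n + 1)} {u : Term n} (h : Eta (.lam t) u) :
    t = app (rename Fin.succ u) (var 0) ∨ ∃ t', Eta t t' ∧ u = .lam t' := by
  cases h with
  | eta _ => exact .inl rfl
  | lam h => exact .inr ⟨_, h, rfl⟩

/-- Substitutions by terms that are no abstractions and reduce to themselves only. -/
def Rigid (σ : Fin m → Term n) : Prop :=
  ∀ i, (∀ t, σ i ≠ lam t) ∧
    ∀ {k : ℕ} (f : Fin n → Fin k) (t : Term k), BetaEta (rename f (σ i)) t → t = rename f (σ i)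

theorem not_betaEta_var (i : Fin n) (t : Term n) : ¬ BetaEta (var i) t := by
  rintro (h | h) <;> cases h

theorem rigid_var (f : Fin m → Fin n) : Rigid fun i => var (f i) :=
  fun _ => ⟨fun _ h => (by cases h), fun _ _ h => (not_betaEta_var _ _ h).elim⟩

theorem Rigid.up {σ : Fin m → Term n} (h : Rigid σ) : Rigid (up σ) := by
  intro i
  cases i using Fin.cases with
  | zero => exact ⟨fun _ h => (by cases h), fun _ _ h => (not_betaEta_var _ _ h).elim⟩
  | succ i =>
    refine ⟨fun t ht => ?_, fun f t ht => ?_⟩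
    · rw [up_succ] at ht
      cases hs : σ i with
      | lam u => exact (h i).1 u hs
      | _ => simp [hs] at ht
    · rw [up_succ, rename_rename] at ht ⊢
      exact (h i).2 _ t ht

theorem Rigid.eq {σ : Fin m → Term n} (h : Rigid σ) {i : Fin m} {t : Term n}
    (ht : BetaEta (σ i) t) : t = σ i := by
  have := (h i).2 id t
  rw [show rename id (σ i) = σ i from rename_id _] at this
  exact this ht

theorem Rigid.beta_subst {t : Term m} : ∀ {n : ℕ} {σ : Fin m → Term n} {u : Term n}, Rigid σ →
    Beta (subst σ t) u → ∃ t', u = subst σ t' ∧ ReflGen Beta t t' := by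
  induction t with
  | var i => intro n σ u hσ h; exact ⟨var i, hσ.eq (.inl h), .refl⟩
  | app s t ihs iht =>
    intro n σ u hσ h
    rw [subst_app] at h
    rcases h.app_inv with ⟨v, hv, rfl⟩ | ⟨s', hs, rfl⟩ | ⟨t', ht, rfl⟩
    · cases s with
      | var i => exact ((hσ i).1 v hv).elim
      | app => cases hv
      | lam s =>
        simp only [subst_lam, lam.injEq] at hv
        subst hv
        exact ⟨inst s t, (subst_inst _ _ _).symm, .single (.beta _ _)⟩
    · obtain ⟨s', rfl, hr⟩ := ihs hσ hs
      refine ⟨app s' t, rfl, ?_⟩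
      cases hr with
      | refl => exact .refl
      | single hr => exact .single (.appL _ hr)
    · obtain ⟨t', rfl, hr⟩ := iht hσ ht
      refine ⟨app s t', rfl, ?_⟩
      cases hr with
      | refl => exact .refl
      | single hr => exact .single (.appR _ hr)
  | lam t ih =>
    intro n σ u hσ h
    rw [subst_lam] at h
    obtain ⟨t', ht, rfl⟩ := h.lam_inv
    obtain ⟨t', rfl, hr⟩ := ih hσ.up ht
    refine ⟨.lam t', rfl, ?_⟩
    cases hr with
    | refl => exact .refl
    | single hr => exact .single (.lam hr)

theorem Rigid.eta_subst {t : Term m} : ∀ {n : ℕ} {σ : Fin m → Term n} {u : Term n}, Rigid σ →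
    Eta (subst σ t) u → ∃ t', u = subst σ t' ∧ ReflGen Eta t t' := by
  induction t with
  | var i => intro n σ u hσ h; exact ⟨var i, hσ.eq (.inr h), .refl⟩
  | app s t ihs iht =>
    intro n σ u hσ h
    rw [subst_app] at h
    rcases h.app_inv with ⟨s', hs, rfl⟩ | ⟨t', ht, rfl⟩
    · obtain ⟨s', rfl, hr⟩ := ihs hσ hs
      refine ⟨app s' t, rfl, ?_⟩
      cases hr with
      | refl => exact .refl
      | single hr => exact .single (.appL _ hr)
    · obtain ⟨t', rfl, hr⟩ := iht hσ ht
      refine ⟨app s t', rfl, ?_⟩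
      cases hr with
      | refl => exact .refl
      | single hr => exact .single (.appR _ hr)
  | lam t ih =>
    intro n σ u hσ h
    rw [subst_lam] at h
    rcases h.lam_inv with ht | ⟨t', ht, rfl⟩
    · cases t with
      | var i =>
        cases i using Fin.cases with
        | zero => cases ht
        | succ i =>
          rw [subst_var, up_succ] at ht
          cases hs : σ i with
          | app a b =>
            simp only [hs, rename_app, app.injEq] at ht
            cases b <;> simp [Fin.succ_ne_zero] at ht
          | _ => simp [hs] at ht
      | app a b =>
        simp only [subst_app, app.injEq] at ht
        obtain ⟨a, rfl, rfl⟩ := exists_of_subst_up_eq_rename ht.1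
        rw [eq_var_zero_of_subst_up ht.2]
        exact ⟨a, rfl, .single (.eta a)⟩
      | lam => cases ht
    · obtain ⟨t', rfl, hr⟩ := ih hσ.up ht
      refine ⟨.lam t', rfl, ?_⟩
      cases hr with
      | refl => exact .refl
      | single hr => exact .single (.lam hr)

theorem Rigid.betaEta_subst {t : Term m} {σ : Fin m → Term n} {u : Term n} (hσ : Rigid σ)
    (h : BetaEta (subst σ t) u) : ∃ t', u = subst σ t' ∧ ReflGen BetaEta t t' := by
  rcases h with h | h
  · obtain ⟨t', rfl, hr⟩ := hσ.beta_subst h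
    exact ⟨t', rfl, hr.mono fun _ _ => .inl⟩
  · obtain ⟨t', rfl, hr⟩ := hσ.eta_subst h
    exact ⟨t', rfl, hr.mono fun _ _ => .inr⟩

theorem Rigid.betaEtaRed_subst {t : Term m} {σ : Fin m → Term n} {u : Term n} (hσ : Rigid σ)
    (h : BetaEtaRed (subst σ t) u) : ∃ t', u = subst σ t' ∧ BetaEtaRed t t' := by
  induction h with
  | refl => exact ⟨t, rfl, .refl t⟩
  | tail _ h ih =>
    obtain ⟨t', rfl, ht⟩ := ih
    obtain ⟨t'', rfl, ht'⟩ := hσ.betaEta_subst h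
    exact ⟨t'', rfl, ht.trans ht'.to_reflTransGen⟩

theorem Beta.rename_inv {f : Fin m → Fin n} {t : Term m} {u : Term n} (h : Beta (rename f t) u) :
    ∃ t', u = rename f t' ∧ ReflGen Beta t t' := by
  simp only [rename_eq_subst] at h ⊢
  exact (rigid_var f).beta_subst h

theorem Eta.rename_inv {f : Fin m → Fin n} {t : Term m} {u : Term n} (h : Eta (rename f t) u) :
    ∃ t', u = rename f t' ∧ ReflGen Eta t t' := by
  simp only [rename_eq_subst] at h ⊢
  exact (rigid_var f).eta_subst h

/-- Parallel `β`-reduction. -/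
inductive Par : {n : ℕ} → Term n → Term n → Prop
  | var {n : ℕ} (i : Fin n) : Par (var i) (var i)
  | app {n : ℕ} {s s' t t' : Term n} : Par s s' → Par t t' → Par (app s t) (app s' t')
  | lam {n : ℕ} {t t' : Term (n + 1)} : Par t t' → Par (lam t) (lam t')
  | beta {n : ℕ} {s s' : Term (n + 1)} {t t' : Term n} : Par s s' → Par t t' →
      Par (app (lam s) t) (inst s' t')

theorem Par.refl (t : Term n) : Par t t := by
  induction t with
  | var i => exact .var i
  | app s t ihs iht => exact .app ihs iht
  | lam t ih => exact .lam ih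

theorem Par.rename {s t : Term m} (h : Par s t) :
    ∀ {n : ℕ} (f : Fin m → Fin n), Par (rename f s) (rename f t) := by
  induction h with
  | var i => intro n f; exact .refl _
  | app _ _ ih₁ ih₂ => intro n f; exact .app (ih₁ f) (ih₂ f)
  | lam _ ih => intro n f; exact .lam (ih _)
  | beta _ _ ih₁ ih₂ => intro n f; rw [rename_inst]; exact .beta (ih₁ _) (ih₂ f)

theorem Par.subst {s t : Term m} (h : Par s t) :
    ∀ {n : ℕ} {σ τ : Fin m → Term n}, (∀ i, Par (σ i) (τ i)) → Par (subst σ s) (subst τ t) := by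
  have hup : ∀ {m n : ℕ} {σ τ : Fin m → Term n}, (∀ i, Par (σ i) (τ i)) →
      ∀ i, Par (up σ i) (up τ i) := by
    intro m n σ τ h i
    cases i using Fin.cases with
    | zero => exact .refl _
    | succ i => exact (h i).rename _
  induction h with
  | var i => intro n σ τ hs; exact hs i
  | app _ _ ih₁ ih₂ => intro n σ τ hs; exact .app (ih₁ hs) (ih₂ hs)
  | lam _ ih => intro n σ τ hs; exact .lam (ih (hup hs))
  | beta _ _ ih₁ ih₂ =>
    intro n σ τ hs
    rw [subst_inst]
    exact .beta (ih₁ (hup hs)) (ih₂ hs)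

theorem Par.inst {s s' : Term (n + 1)} {t t' : Term n} (h : Par s s') (h' : Par t t') :
    Par (inst s t) (inst s' t') := by
  refine h.subst fun i => ?_
  cases i using Fin.cases with
  | zero => exact h'
  | succ i => exact .refl _

theorem Par.diamond {s t : Term n} (h : Par s t) : ∀ {u}, Par s u → ∃ v, Par t v ∧ Par u v := by
  induction h with
  | var i => intro u hu; cases hu; exact ⟨_, .var i, .var i⟩
  | app h₁ h₂ ih₁ ih₂ =>
    intro u hu
    cases hu with
    | app h₁' h₂' =>
      obtain ⟨v, hv, hv'⟩ := ih₁ h₁'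
      obtain ⟨w, hw, hw'⟩ := ih₂ h₂'
      exact ⟨_, .app hv hw, .app hv' hw'⟩
    | beta h₁' h₂' =>
      obtain ⟨w, hw, hw'⟩ := ih₂ h₂'
      cases h₁ with
      | lam h₁ =>
        obtain ⟨v, hv, hv'⟩ := ih₁ (.lam h₁')
        cases hv with
        | lam hv => cases hv' with
          | lam hv' => exact ⟨_, .beta hv hw, hv'.inst hw'⟩
  | lam _ ih =>
    intro u hu
    cases hu with
    | lam h =>
      obtain ⟨v, hv, hv'⟩ := ih h
      exact ⟨_, .lam hv, .lam hv'⟩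
  | beta h₁ h₂ ih₁ ih₂ =>
    intro u hu
    cases hu with
    | app h₁' h₂' =>
      obtain ⟨w, hw, hw'⟩ := ih₂ h₂'
      cases h₁' with
      | lam h₁' =>
        obtain ⟨v, hv, hv'⟩ := ih₁ h₁'
        exact ⟨_, hv.inst hw, .beta hv' hw'⟩
    | beta h₁' h₂' =>
      obtain ⟨v, hv, hv'⟩ := ih₁ h₁'
      obtain ⟨w, hw, hw'⟩ := ih₂ h₂'
      exact ⟨_, hv.inst hw, hv'.inst hw'⟩

theorem Beta.par {s t : Term n} (h : Beta s t) : Par s t := by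
  induction h with
  | beta t u => exact .beta (.refl _) (.refl _)
  | appL t _ ih => exact .app ih (.refl _)
  | appR s _ ih => exact .app (.refl _) ih
  | lam _ ih => exact .lam ih

theorem Par.betaRed {s t : Term n} (h : Par s t) : BetaRed s t := by
  induction h with
  | var i => exact .refl
  | app _ _ ih₁ ih₂ => exact ih₁.app ih₂
  | lam _ ih => exact ih.lam
  | beta _ _ ih₁ ih₂ => exact (ih₁.lam.app ih₂).tail (.beta _ _)

theorem BetaRed.confluent {s t u : Term n} (h : BetaRed s t) (h' : BetaRed s u) :
    ∃ v, BetaRed t v ∧ BetaRed u v := by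
  obtain ⟨v, hv, hv'⟩ := church_rosser (r := Par)
    (fun a b c hab hac => by
      obtain ⟨d, hd, hd'⟩ := hab.diamond hac
      exact ⟨d, .single hd, .single hd'⟩)
    (mono_red (fun _ _ => Beta.par) h) (mono_red (fun _ _ => Beta.par) h')
  have key : ∀ {a b : Term n}, ReflTransGen Par a b → BetaRed a b := fun h => by
    induction h with
    | refl => exact .refl
    | tail _ h ih => exact ih.trans h.betaRed
  exact ⟨v, key hv, key hv'⟩

/-- Parallel `η`-reduction. -/
inductive EtaPar : {n : ℕ} → Term n → Term n → Prop
  | var {n : ℕ} (i : Fin n) : EtaPar (var i) (var i)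
  | app {n : ℕ} {s s' t t' : Term n} : EtaPar s s' → EtaPar t t' →
      EtaPar (app s t) (app s' t')
  | lam {n : ℕ} {t t' : Term (n + 1)} : EtaPar t t' → EtaPar (lam t) (lam t')
  | eta {n : ℕ} {t t' : Term n} : EtaPar t t' →
      EtaPar (lam (app (rename Fin.succ t) (.var 0))) t'

theorem EtaPar.refl (t : Term n) : EtaPar t t := by
  induction t with
  | var i => exact .var i
  | app s t ihs iht => exact .app ihs iht
  | lam t ih => exact .lam ih

theorem EtaPar.rename {s t : Term m} (h : EtaPar s t) :
    ∀ {n : ℕ} (f : Fin m → Fin n), EtaPar (rename f s) (rename f t) := by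
  induction h with
  | var i => intro n f; exact .refl _
  | app _ _ ih₁ ih₂ => intro n f; exact .app (ih₁ f) (ih₂ f)
  | lam _ ih => intro n f; exact .lam (ih _)
  | eta _ ih =>
    intro n f
    simp only [rename_lam, rename_app, rename_upr_rename_succ]
    exact .eta (ih f)

theorem EtaPar.subst {s t : Term m} (h : EtaPar s t) :
    ∀ {n : ℕ} {σ τ : Fin m → Term n}, (∀ i, EtaPar (σ i) (τ i)) →
      EtaPar (subst σ s) (subst τ t) := by
  have hup : ∀ {m n : ℕ} {σ τ : Fin m → Term n}, (∀ i, EtaPar (σ i) (τ i)) →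
      ∀ i, EtaPar (up σ i) (up τ i) := by
    intro m n σ τ h i
    cases i using Fin.cases with
    | zero => exact .refl _
    | succ i => exact (h i).rename _
  induction h with
  | var i => intro n σ τ hs; exact hs i
  | app _ _ ih₁ ih₂ => intro n σ τ hs; exact .app (ih₁ hs) (ih₂ hs)
  | lam _ ih => intro n σ τ hs; exact .lam (ih (hup hs))
  | eta _ ih =>
    intro n σ τ hs
    simp only [subst_lam, subst_app, subst_up_rename_succ]
    exact .eta (ih hs)

theorem EtaPar.inst {s s' : Term (n + 1)} {t t' : Term n} (h : EtaPar s s') (h' : EtaPar t t') :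
    EtaPar (inst s t) (inst s' t') := by
  refine h.subst fun i => ?_
  cases i using Fin.cases with
  | zero => exact h'
  | succ i => exact .refl _

theorem Eta.par {s t : Term n} (h : Eta s t) : EtaPar s t := by
  induction h with
  | eta t => exact .eta (.refl _)
  | appL t _ ih => exact .app ih (.refl _)
  | appR s _ ih => exact .app (.refl _) ih
  | lam _ ih => exact .lam ih

theorem EtaPar.etaRed {s t : Term n} (h : EtaPar s t) : EtaRed s t := by
  induction h with
  | var i => exact .refl
  | app _ _ ih₁ ih₂ => exact ih₁.app ih₂
  | lam _ ih => exact ih.lam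
  | eta _ ih => exact .head (.eta _) ih

theorem EtaPar.commute {s t : Term n} (h : EtaPar s t) :
    ∀ {u}, Beta s u → ∃ v, BetaRed t v ∧ EtaPar u v := by
  induction h with
  | var i => intro u hu; cases hu
  | app h₁ h₂ ih₁ ih₂ =>
    intro u hu
    cases hu with
    | beta a _ =>
      cases h₁ with
      | lam h₁ => exact ⟨_, .single (.beta _ _), h₁.inst h₂⟩
      | eta h₁ =>
        refine ⟨_, .refl, ?_⟩
        simpa using EtaPar.app h₁ h₂
    | appL _ h =>
      obtain ⟨v, hv, hv'⟩ := ih₁ h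
      exact ⟨_, hv.app .refl, hv'.app h₂⟩
    | appR _ h =>
      obtain ⟨v, hv, hv'⟩ := ih₂ h
      exact ⟨_, BetaRed.app .refl hv, h₁.app hv'⟩
  | lam _ ih =>
    intro u hu
    cases hu with
    | lam h =>
      obtain ⟨v, hv, hv'⟩ := ih h
      exact ⟨_, hv.lam, .lam hv'⟩
  | @eta _ p q h ih =>
    intro u hu
    obtain ⟨w, hw, rfl⟩ := hu.lam_inv
    rcases hw.app_inv with ⟨v, hv, rfl⟩ | ⟨s', hs, rfl⟩ | ⟨t', ht, rfl⟩
    · cases p with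
      | lam p =>
        simp only [rename_lam, lam.injEq] at hv
        subst hv
        exact ⟨_, .refl, by simpa using h⟩
      | _ => cases hv
    · obtain ⟨p', rfl, hp⟩ := hs.rename_inv
      cases hp with
      | refl => exact ⟨_, .refl, .eta h⟩
      | single hp =>
        obtain ⟨v, hv, hv'⟩ := ih hp
        exact ⟨v, hv, .eta hv'⟩
    · cases ht

theorem commute_red {α : Type*} {r p : α → α → Prop}
    (h : ∀ a b c, r a b → p a c → ∃ d, ReflTransGen p b d ∧ r c d) {a b c : α}
    (hab : ReflTransGen r a b) (hac : ReflTransGen p a c) :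
    ∃ d, ReflTransGen p b d ∧ ReflTransGen r c d := by
  have strip : ∀ {a b c}, r a b → ReflTransGen p a c → ∃ d, ReflTransGen p b d ∧ r c d := by
    intro a b c hab hac
    induction hac with
    | refl => exact ⟨b, .refl, hab⟩
    | tail _ h' ih =>
      obtain ⟨d, hd, hd'⟩ := ih
      obtain ⟨e, he, he'⟩ := h _ _ _ hd' h'
      exact ⟨e, hd.trans he, he'⟩
  induction hab with
  | refl => exact ⟨c, hac, .refl⟩
  | tail _ h' ih =>
    obtain ⟨d, hd, hd'⟩ := ih
    obtain ⟨e, he, he'⟩ := strip h' hd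
    exact ⟨e, he, hd'.tail he'⟩

theorem EtaRed.commute {s t u : Term n} (h : EtaRed s t) (h' : BetaRed s u) :
    ∃ v, BetaRed t v ∧ EtaRed u v := by
  obtain ⟨v, hv, hv'⟩ := commute_red (r := EtaPar) (p := Beta) (fun _ _ _ h h' => h.commute h')
    (mono_red (fun _ _ => Eta.par) h) h'
  refine ⟨v, hv, ?_⟩
  clear hv
  induction hv' with
  | refl => exact .refl
  | tail _ h ih => exact ih.trans h.etaRed

theorem Eta.local_confluent {s t : Term n} (h : Eta s t) :
    ∀ {u}, Eta s u → ∃ v, ReflGen Eta t v ∧ ReflGen Eta u v := by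
  have key : ∀ {n : ℕ} {p : Term n} {w : Term (n + 1)},
      Eta (.app (Term.rename Fin.succ p) (var 0)) w →
        ∃ v, ReflGen Eta p v ∧ ReflGen Eta (.lam w) v := by
    intro n p w hw
    rcases hw.app_inv with ⟨s', hs, rfl⟩ | ⟨t', ht, rfl⟩
    · obtain ⟨p', rfl, hp⟩ := hs.rename_inv
      exact ⟨p', hp, .single (.eta _)⟩
    · cases ht
  have map : ∀ {m n : ℕ} (f : Term m → Term n) (_ : ∀ a b, Eta a b → Eta (f a) (f b)) {a b},
      ReflGen Eta a b → ReflGen Eta (f a) (f b) := by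
    intro m n f hf a b h
    cases h with
    | refl => exact .refl
    | single h => exact .single (hf _ _ h)
  induction h with
  | eta t =>
    intro u hu
    rcases hu.lam_inv with h | ⟨w, hw, rfl⟩
    · simp only [app.injEq, and_true] at h
      obtain rfl := rename_injective (Fin.succ_injective _) h
      exact ⟨_, .refl, .refl⟩
    · exact key hw
  | appL t h ih =>
    intro u hu
    rcases hu.app_inv with ⟨s', hs, rfl⟩ | ⟨t', ht, rfl⟩
    · obtain ⟨v, hv, hv'⟩ := ih hs
      exact ⟨_, map (Term.app · t) (fun _ _ => .appL t) hv,
        map (Term.app · t) (fun _ _ => .appL t) hv'⟩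
    · exact ⟨_, .single (.appR _ ht), .single (.appL _ h)⟩
  | appR s h ih =>
    intro u hu
    rcases hu.app_inv with ⟨s', hs, rfl⟩ | ⟨t', ht, rfl⟩
    · exact ⟨_, .single (.appL _ hs), .single (.appR _ h)⟩
    · obtain ⟨v, hv, hv'⟩ := ih ht
      exact ⟨_, map (Term.app s) (fun _ _ => .appR s) hv, map (Term.app s) (fun _ _ => .appR s) hv'⟩
  | lam h ih =>
    intro u hu
    rcases hu.lam_inv with rfl | ⟨w, hw, rfl⟩
    · obtain ⟨v, hv, hv'⟩ := key h
      exact ⟨v, hv', hv⟩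
    · obtain ⟨v, hv, hv'⟩ := ih hw
      exact ⟨_, map Term.lam (fun _ _ => .lam) hv, map Term.lam (fun _ _ => .lam) hv'⟩

theorem EtaRed.confluent {s t u : Term n} (h : EtaRed s t) (h' : EtaRed s u) :
    ∃ v, EtaRed t v ∧ EtaRed u v :=
  church_rosser (fun _ _ _ h h' => by
    obtain ⟨v, hv, hv'⟩ := h.local_confluent h'
    exact ⟨v, hv, hv'.to_reflTransGen⟩) h h'

theorem BetaEtaRed.confluent {s t u : Term n} (h : BetaEtaRed s t) (h' : BetaEtaRed s u) :
    ∃ v, BetaEtaRed t v ∧ BetaEtaRed u v := by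
  let r : Term n → Term n → Prop := fun a b => BetaRed a b ∨ EtaRed a b
  have hto : ∀ {a b : Term n}, BetaEtaRed a b → ReflTransGen r a b := fun h =>
    mono_red (fun _ _ h => h.imp .single .single) h
  have hof : ∀ {a b : Term n}, ReflTransGen r a b → BetaEtaRed a b := fun h => by
    induction h with
    | refl => exact .refl _
    | tail _ h ih => exact ih.trans (h.elim BetaRed.betaEtaRed EtaRed.betaEtaRed)
  obtain ⟨v, hv, hv'⟩ := church_rosser (r := r) (fun a b c hab hac => by
    rcases hab with hab | hab <;> rcases hac with hac | hac
    · obtain ⟨d, hd, hd'⟩ := hab.confluent hac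
      exact ⟨d, .single (.inl hd), .single (.inl hd')⟩
    · obtain ⟨d, hd, hd'⟩ := hac.commute hab
      exact ⟨d, .single (.inr hd'), .single (.inl hd)⟩
    · obtain ⟨d, hd, hd'⟩ := hab.commute hac
      exact ⟨d, .single (.inl hd), .single (.inr hd')⟩
    · obtain ⟨d, hd, hd'⟩ := hab.confluent hac
      exact ⟨d, .single (.inr hd), .single (.inr hd')⟩) (hto h) (hto h')
  exact ⟨v, hof hv, hof hv'⟩

namespace BetaEtaConv

theorem refl (t : Term n) : BetaEtaConv t t := EqvGen.refl t
theorem symm {s t : Term n} (h : BetaEtaConv s t) : BetaEtaConv t s := EqvGen.symm _ _ h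
theorem trans {s t u : Term n} (h : BetaEtaConv s t) (h' : BetaEtaConv t u) : BetaEtaConv s u :=
  EqvGen.trans _ _ _ h h'

end BetaEtaConv

theorem BetaEtaRed.conv {s t : Term n} (h : BetaEtaRed s t) : BetaEtaConv s t := by
  induction h with
  | refl => exact .refl _
  | tail _ h ih => exact ih.trans (.rel _ _ h)

theorem Beta.conv {s t : Term n} (h : Beta s t) : BetaEtaConv s t := .rel _ _ (.inl h)

theorem Eta.conv {s t : Term n} (h : Eta s t) : BetaEtaConv s t := .rel _ _ (.inr h)

theorem BetaEtaConv.join {s t : Term n} (h : BetaEtaConv s t) :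
    ∃ u, BetaEtaRed s u ∧ BetaEtaRed t u := by
  induction h with
  | rel _ _ h => exact ⟨_, .single h, .refl _⟩
  | refl t => exact ⟨t, .refl _, .refl _⟩
  | symm _ _ _ ih => obtain ⟨u, h, h'⟩ := ih; exact ⟨u, h', h⟩
  | trans _ _ _ _ _ ih₁ ih₂ =>
    obtain ⟨u, h, hu⟩ := ih₁
    obtain ⟨v, hv, h'⟩ := ih₂
    obtain ⟨w, hw, hw'⟩ := hu.confluent hv
    exact ⟨w, h.trans hw, h'.trans hw'⟩

theorem BetaEtaConv.map {f : Term m → Term n} (hf : ∀ a b, BetaEta a b → BetaEta (f a) (f b))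
    {s t : Term m} (h : BetaEtaConv s t) : BetaEtaConv (f s) (f t) := by
  induction h with
  | rel _ _ h => exact .rel _ _ (hf _ _ h)
  | refl t => exact .refl _
  | symm _ _ _ ih => exact ih.symm
  | trans _ _ _ _ _ ih₁ ih₂ => exact ih₁.trans ih₂

theorem BetaEtaConv.app {s s' t t' : Term n} (h : BetaEtaConv s s') (h' : BetaEtaConv t t') :
    BetaEtaConv (app s t) (app s' t') :=
  (h.map (f := (Term.app · t)) fun _ _ h => h.appL t).trans
    (h'.map (f := Term.app s') fun _ _ h => h.appR s')

theorem BetaEtaConv.lam {t t' : Term (n + 1)} (h : BetaEtaConv t t') :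
    BetaEtaConv (lam t) (lam t') := h.map fun _ _ h => h.lam

theorem BetaEtaConv.subst {s t : Term m} (h : BetaEtaConv s t) (σ : Fin m → Term n) :
    BetaEtaConv (subst σ s) (subst σ t) := h.map fun _ _ h => h.subst σ

end

theorem BetaRed.of_lam {n : ℕ} {t : Term (n + 1)} {u : Term n} (h : BetaRed (.lam t) u) :
    ∃ t', u = .lam t' := by
  induction h with
  | refl => exact ⟨t, rfl⟩
  | tail _ h ih =>
    obtain ⟨t', rfl⟩ := ih
    obtain ⟨t'', _, rfl⟩ := h.lam_inv
    exact ⟨t'', rfl⟩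

theorem IsZeroTerm.of_red {Z Z' : Term 0} (hZ : IsZeroTerm Z) (h : BetaEtaRed Z Z') :
    IsZeroTerm Z' := by
  intro P hP
  obtain ⟨b, hb⟩ := (h.trans hP.betaEtaRed).whRed_lam
  exact hZ b hb.betaRed

theorem IsZeroTerm.of_betaRed {A Z : Term 0} (hZ : IsZeroTerm Z) (h : BetaRed A Z) :
    IsZeroTerm A := by
  intro P hP
  obtain ⟨W, hW, hW'⟩ := h.confluent hP
  obtain ⟨Q, rfl⟩ := BetaRed.of_lam hW'
  exact hZ Q hW

theorem IsZeroTerm.app_of_etaPar {A Z : Term 0} (hZ : IsZeroTerm Z) (h : EtaPar A Z)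
    (R : Term 0) : IsZeroTerm (app A R) := by
  have key : ∀ T, WhRed (app A R) T →
      ∃ A' Z', T = app A' R ∧ EtaPar A' Z' ∧ IsZeroTerm Z' := by
    intro T hT
    induction hT with
    | refl => exact ⟨A, Z, rfl, h, hZ⟩
    | tail _ hs ih =>
      obtain ⟨A', Z', rfl, h', hZ'⟩ := ih
      cases hs with
      | beta t _ =>
        cases h' with
        | lam _ => exact (hZ' _ .refl).elim
        | eta h' => exact ⟨_, _, by simp, h', hZ'⟩
      | appL _ hs =>
        obtain ⟨Z'', hZ'', h''⟩ := h'.commute hs.toBeta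
        exact ⟨_, _, rfl, h'', hZ'.of_red hZ''.betaEtaRed⟩
  intro P hP
  obtain ⟨b, hb⟩ := hP.betaEtaRed.whRed_lam
  obtain ⟨_, _, h, _⟩ := key _ hb
  cases h

/-- Closed terms all of whose applications to `p` closed terms are zero-terms. -/
def ZeroAfter : ℕ → Term 0 → Prop
  | 0, A => IsZeroTerm A
  | p + 1, A => ∀ R, ZeroAfter p (app A R)

theorem ZeroAfter.of_betaRed {p : ℕ} {A B : Term 0} (h : BetaRed A B) (hB : ZeroAfter p B) :
    ZeroAfter p A := by
  induction p generalizing A B with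
  | zero => exact IsZeroTerm.of_betaRed hB h
  | succ p ih => exact fun R => ih (h.app .refl) (hB R)

theorem ZeroAfter.of_etaPar {p : ℕ} {A B : Term 0} (h : EtaPar A B) (hB : ZeroAfter p B) :
    ZeroAfter (p + 1) A := by
  induction p generalizing A B with
  | zero => exact fun R => IsZeroTerm.app_of_etaPar hB h R
  | succ p ih => exact fun R => ih (h.app (.refl R)) (hB R)

/-- Closed terms that `βη`-reduce to a zero-term. -/
def ReducesToZero (A : Term 0) : Prop := ∃ Z : Term 0, IsZeroTerm Z ∧ BetaEtaRed A Z

theorem ReducesToZero.zeroAfter {A : Term 0} (h : ReducesToZero A) : ∃ p, ZeroAfter p A := by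
  obtain ⟨Z, hZ, h⟩ := h
  induction h using ReflTransGen.head_induction_on with
  | refl => exact ⟨0, hZ⟩
  | head h _ ih =>
    obtain ⟨p, hp⟩ := ih
    rcases h with h | h
    · exact ⟨p, hp.of_betaRed (.single h)⟩
    · exact ⟨p + 1, hp.of_etaPar h.par⟩

theorem ReducesToZero.of_conv {A B : Term 0} (hA : ReducesToZero A) (h : BetaEtaConv A B) :
    ReducesToZero B := by
  obtain ⟨Z, hZ, hAZ⟩ := hA
  obtain ⟨W, hBW, hZW⟩ := (h.symm.trans hAZ.conv).join
  exact ⟨W, hZ.of_red hZW, hBW⟩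

section
variable {m n : ℕ}

/-- Terms that reduce to themselves only. -/
def Stable (t : Term n) : Prop := ∀ t', BetaEta t t' → t' = t

namespace Stable

theorem of_isNormal {t : Term n} (h : IsNormal t) : Stable t := fun t' ht => (h t' ht).elim

theorem lam_body {t : Term (n + 1)} (h : Stable (lam t)) : Stable t :=
  fun t' ht => by simpa using h _ ht.lam

theorem app_left {s t : Term n} (h : Stable (app s t)) : Stable s :=
  fun s' hs => by simpa using h _ (hs.appL t)

theorem app_right {s t : Term n} (h : Stable (app s t)) : Stable t :=
  fun t' ht => by simpa using h _ (ht.appR s)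

theorem var (i : Fin n) : Stable (.var i) := fun t h => (not_betaEta_var i t h).elim

theorem app {s t : Term n} (hs : Stable s) (ht : Stable t) (h : ∀ u, s ≠ .lam u) :
    Stable (.app s t) := by
  rintro v (hv | hv)
  · rcases hv.app_inv with ⟨u, hu, _⟩ | ⟨s', h', rfl⟩ | ⟨t', h', rfl⟩
    · exact (h u hu).elim
    · rw [hs _ (.inl h')]
    · rw [ht _ (.inl h')]
  · rcases hv.app_inv with ⟨s', h', rfl⟩ | ⟨t', h', rfl⟩
    · rw [hs _ (.inr h')]
    · rw [ht _ (.inr h')]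

theorem lam {t : Term (n + 1)} (ht : Stable t) (h : ∀ u, t ≠ .app (rename Fin.succ u) (.var 0)) :
    Stable (.lam t) := by
  rintro v (hv | hv)
  · obtain ⟨t', h', rfl⟩ := hv.lam_inv
    rw [ht _ (.inl h')]
  · rcases hv.lam_inv with h' | ⟨t', h', rfl⟩
    · exact (h _ h').elim
    · rw [ht _ (.inr h')]

theorem eq_of_red {s t : Term n} (hs : Stable s) (h : BetaEtaRed s t) : t = s := by
  induction h with
  | refl => rfl
  | tail _ h ih => subst ih; exact hs _ h

theorem red_of_conv {s t : Term n} (hs : Stable s) (h : BetaEtaConv t s) : BetaEtaRed t s := by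
  obtain ⟨u, hu, hu'⟩ := h.join
  rwa [hs.eq_of_red hu'] at hu

theorem subst {s : Term m} {σ : Fin m → Term n} (hs : Stable s) (hσ : Rigid σ) :
    Stable (subst σ s) := by
  intro t ht
  obtain ⟨s', rfl, h⟩ := hσ.betaEta_subst ht
  rw [hs.eq_of_red h.to_reflTransGen]

theorem rename {s : Term m} (hs : Stable s) (f : Fin m → Fin n) : Stable (rename f s) := by
  rw [rename_eq_subst]
  exact hs.subst (rigid_var f)

end Stable

/-- Stable terms applied to variables. -/
inductive QuasiStable : Term n → Prop
  | base {t : Term n} : Stable t → QuasiStable t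
  | app {t : Term n} (i : Fin n) : QuasiStable t → QuasiStable (app t (.var i))

namespace QuasiStable

theorem rename {t : Term m} (h : QuasiStable t) (f : Fin m → Fin n) :
    QuasiStable (rename f t) := by
  induction h with
  | base h => exact .base (h.rename f)
  | app i _ ih => exact .app (f i) ih

theorem exists_stable {t : Term n} (h : QuasiStable t) : ∃ s, Stable s ∧ BetaEtaRed t s := by
  induction h with
  | base h => exact ⟨_, h, .refl _⟩
  | @app t i _ ih =>
    obtain ⟨s, hs, ht⟩ := ih
    by_cases h : ∃ u, s = lam u
    · obtain ⟨u, rfl⟩ := h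
      refine ⟨inst u (.var i), ?_, (ht.app (.refl _)).tail (.inl (.beta _ _))⟩
      rw [inst_eq, show single (.var i) = fun j => .var (Fin.cases i id j) from ?_]
      · exact hs.lam_body.subst (rigid_var _)
      · funext j
        cases j using Fin.cases <;> rfl
    · exact ⟨_, hs.app (.var i) fun u hu => h ⟨u, hu⟩, ht.app (.refl _)⟩

theorem of_lam {t : Term (n + 1)} (h : QuasiStable (lam t)) : QuasiStable t := by
  cases h with
  | base h => exact .base h.lam_body

theorem of_app {s t : Term n} (h : QuasiStable (.app s t)) : QuasiStable s ∧ QuasiStable t := by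
  cases h with
  | base h => exact ⟨.base h.app_left, .base h.app_right⟩
  | app i h => exact ⟨h, .base (.var i)⟩

end QuasiStable

end

/-- An infinite family of closed normal forms `λ y₀ … yₖ. yₖ`. -/
def selector : {n : ℕ} → ℕ → Term n
  | _, 0 => lam (var 0)
  | _, k + 1 => lam (selector k)

/-- The term `(λ x. x x) (λ x. x x)`. -/
def omegaTerm {n : ℕ} : Term n :=
  app (lam (app (var 0) (var 0))) (lam (app (var 0) (var 0)))

/-- An infinite family of closed stable terms, which behave like free variables. -/
def generic {n : ℕ} (k : ℕ) : Term n := app omegaTerm (selector k)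

section
variable {m n : ℕ}

theorem rename_selector (k : ℕ) : ∀ {m n : ℕ} (f : Fin m → Fin n),
    rename f (selector k) = selector k := by
  induction k with
  | zero => intros; rfl
  | succ k ih => intro m n f; exact congrArg lam (ih _)

theorem rename_generic (k : ℕ) (f : Fin m → Fin n) : rename f (generic k) = generic k :=
  congrArg (app _) (rename_selector k f)

theorem selector_injective {j k : ℕ} (h : (selector j : Term n) = selector k) : j = k := by
  induction j generalizing n k with
  | zero =>
    cases k with
    | zero => rfl
    | succ k => cases k <;> cases h
  | succ j ih =>
    cases k with
    | zero => cases j <;> cases h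
    | succ k =>
      simp only [selector, lam.injEq] at h
      rw [ih h]

theorem generic_injective {j k : ℕ} (h : (generic j : Term n) = generic k) : j = k := by
  simp only [generic, app.injEq, true_and] at h
  exact selector_injective h

theorem stable_selector (k : ℕ) : ∀ {n : ℕ}, Stable (selector k : Term n) := by
  induction k with
  | zero => intro n; exact .lam (.var 0) fun u hu => by cases hu
  | succ k ih =>
    intro n
    exact .lam ih fun u hu => by cases k <;> cases hu

theorem stable_generic (k : ℕ) : Stable (generic k : Term n) := by
  have h : Stable (lam (app (var 0) (var 0)) : Term n) :=
    .lam (.app (.var 0) (.var 0) fun u hu => by cases hu) fun u hu => by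
      cases u with
      | var i => simp [(Fin.succ_ne_zero _).symm] at hu
      | _ => cases hu
  refine .app ?_ (stable_selector k) fun u hu => by cases hu
  rintro v (hv | hv)
  · rcases hv.app_inv with ⟨u, hu, rfl⟩ | ⟨s', h', rfl⟩ | ⟨t', h', rfl⟩
    · cases hu
      rfl
    · rw [h _ (.inl h')]; rfl
    · rw [h _ (.inl h')]; rfl
  · rcases hv.app_inv with ⟨s', h', rfl⟩ | ⟨t', h', rfl⟩
    · rw [h _ (.inr h')]; rfl
    · rw [h _ (.inr h')]; rfl

theorem rigid_generic (f : Fin m → ℕ) : Rigid (fun i => (generic (f i) : Term n)) :=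
  fun _ => ⟨fun _ h => (by cases h), fun g _ h => by
    rw [rename_generic] at h ⊢
    exact stable_generic _ _ h⟩

theorem ne_lam_up {σ : Fin m → Term n} (h : ∀ i t, σ i ≠ lam t) : ∀ i t, up σ i ≠ lam t := by
  intro i t ht
  cases i using Fin.cases with
  | zero => cases ht
  | succ i =>
    rw [up_succ] at ht
    cases hs : σ i with
    | lam u => exact h i u hs
    | _ => simp [hs] at ht

theorem eq_selector_of_subst (k : ℕ) : ∀ {m n : ℕ} {σ : Fin m → Term n} {t : Term m},
    (∀ i t, σ i ≠ lam t) → subst σ t = selector k → t = selector k := by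
  induction k with
  | zero =>
    intro m n σ t hσ h
    cases t with
    | var i => exact (hσ i _ h).elim
    | app s t => cases h
    | lam t =>
      simp only [subst_lam, selector, lam.injEq] at h
      rw [eq_var_zero_of_subst_up h]
      rfl
  | succ k ih =>
    intro m n σ t hσ h
    cases t with
    | var i => exact (hσ i _ h).elim
    | app s t => cases h
    | lam t =>
      simp only [subst_lam, selector, lam.injEq] at h
      rw [ih (ne_lam_up hσ) h]
      rfl

/-- Two substitutions that map a variable to the same variable or to distinct generic terms. -/
def Separating (σ τ : Fin m → Term n) : Prop :=
  Function.Injective σ ∧ ∀ i, (∃ j, σ i = var j ∧ τ i = var j) ∨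
    ∃ k, σ i = generic (2 * k) ∧ τ i = generic (2 * k + 1)

namespace Separating

theorem up {σ τ : Fin m → Term n} (h : Separating σ τ) : Separating (up σ) (up τ) := by
  have hne : ∀ i, Term.var 0 ≠ rename Fin.succ (σ i) := by
    intro i hi
    cases hs : σ i <;> simp [hs, (Fin.succ_ne_zero _).symm] at hi
  refine ⟨fun i j hij => ?_, fun i => ?_⟩
  · cases i using Fin.cases with
    | zero =>
      cases j using Fin.cases with
      | zero => rfl
      | succ j => exact (hne j hij).elim
    | succ i =>
      cases j using Fin.cases with
      | zero => exact (hne i hij.symm).elim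
      | succ j => exact congrArg Fin.succ (h.1 (rename_injective (Fin.succ_injective _) hij))
  · cases i using Fin.cases with
    | zero => exact .inl ⟨0, rfl, rfl⟩
    | succ i =>
      rcases h.2 i with ⟨j, h₁, h₂⟩ | ⟨k, h₁, h₂⟩
      · exact .inl ⟨j.succ, by simp [h₁], by simp [h₂]⟩
      · exact .inr ⟨k, by simp [h₁, rename_generic], by simp [h₂, rename_generic]⟩

theorem ne_lam {σ τ : Fin m → Term n} (h : Separating σ τ) (i : Fin m) (t : Term (n + 1)) :
    σ i ≠ lam t ∧ τ i ≠ lam t := by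
  rcases h.2 i with ⟨j, h₁, h₂⟩ | ⟨k, h₁, h₂⟩ <;> rw [h₁, h₂] <;>
    exact ⟨fun h => (by cases h), fun h => (by cases h)⟩

theorem ne_app {σ τ : Fin m → Term n} (h : Separating σ τ) {i : Fin m} {s t : Term m}
    (h₁ : σ i = subst σ (app s t)) (h₂ : τ i = subst τ (app s t)) : False := by
  rcases h.2 i with ⟨j, hσ, _⟩ | ⟨k, hσ, hτ⟩
  · rw [hσ] at h₁
    cases h₁
  · rw [hσ] at h₁
    rw [hτ] at h₂
    simp only [generic, subst_app, app.injEq] at h₁ h₂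
    have h₃ := eq_selector_of_subst _ (fun i t => (h.ne_lam i t).1) h₁.2.symm
    have h₄ := eq_selector_of_subst _ (fun i t => (h.ne_lam i t).2) h₂.2.symm
    have := selector_injective (h₃.symm.trans h₄)
    omega

theorem eq {s : Term m} : ∀ {n : ℕ} {σ τ : Fin m → Term n} {t : Term m}, Separating σ τ →
    subst σ s = subst σ t → subst τ s = subst τ t → s = t := by
  induction s with
  | var i =>
    intro n σ τ t h h₁ h₂
    cases t with
    | var j => rw [h.1 h₁]
    | app a b => exact (h.ne_app h₁ h₂).elim
    | lam a => exact ((h.ne_lam i _).1 h₁).elim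
  | app a b iha ihb =>
    intro n σ τ t h h₁ h₂
    cases t with
    | var j => exact (h.ne_app h₁.symm h₂.symm).elim
    | app a' b' =>
      simp only [subst_app, app.injEq] at h₁ h₂
      rw [iha h h₁.1 h₂.1, ihb h h₁.2 h₂.2]
    | lam a' => cases h₁
  | lam a ih =>
    intro n σ τ t h h₁ h₂
    cases t with
    | var j => exact ((h.ne_lam j _).1 h₁.symm).elim
    | app a' b' => cases h₁
    | lam a' =>
      simp only [subst_lam, lam.injEq] at h₁ h₂
      rw [ih h.up h₁ h₂]

end Separating

namespace Term

/-- The variable in head position of a term `x t₁ ⋯ tₖ`. -/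
def headVar : {n : ℕ} → Term n → Option (Fin n)
  | _, var i => some i
  | _, app s _ => headVar s
  | _, lam _ => none

theorem headVar_apps (s : Term n) (ts : List (Term n)) : headVar (apps s ts) = headVar s := by
  induction ts generalizing s with
  | nil => rfl
  | cons t ts ih => exact ih (app s t)

theorem headVar_emb (t : Term 0) : headVar (emb t : Term n) = none := by
  have : ∀ {m : ℕ} (t : Term m) (f : Fin m → Fin n),
      headVar (rename f t) = (headVar t).map f := by
    intro m t
    induction t with
    | var i => intro f; rfl
    | app s t ih _ => intro f; exact ih f
    | lam t _ => intro f; rfl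
  rw [emb, this]
  cases h : headVar t with
  | none => rfl
  | some i => exact i.elim0

theorem eq_apps_of_headVar {s : Term n} {i : Fin n} (h : headVar s = some i) :
    ∃ ts, s = apps (var i) ts := by
  induction s with
  | var j =>
    simp only [headVar, Option.some.injEq] at h
    subst h
    exact ⟨[], rfl⟩
  | app s t ih _ =>
    obtain ⟨ts, rfl⟩ := ih h
    exact ⟨ts ++ [t], (apps_append_singleton _ _ _).symm⟩
  | lam t => cases h

end Term

/-- Two substitutions that map a variable to the same variable, or to `M` and `N`. -/
def Swapping (M N : Term 0) (θ θ' : Fin m → Term n) : Prop :=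
  ∀ i, (∃ j, θ i = var j ∧ θ' i = var j) ∨ (θ i = emb M ∧ θ' i = emb N)

theorem Swapping.up {M N : Term 0} {θ θ' : Fin m → Term n} (h : Swapping M N θ θ') :
    Swapping M N (up θ) (up θ') := by
  intro i
  cases i using Fin.cases with
  | zero => exact .inl ⟨0, rfl, rfl⟩
  | succ i =>
    rcases h i with ⟨j, h₁, h₂⟩ | ⟨h₁, h₂⟩
    · exact .inl ⟨j.succ, by simp [h₁], by simp [h₂]⟩
    · exact .inr ⟨by simp [h₁], by simp [h₂]⟩

/-- No variable in head position is replaced by a closed term. -/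
def HeadFixed (θ θ' : Fin m → Term n) (b : Term m) : Prop :=
  ∀ i, headVar b = some i → ∃ j, θ i = var j ∧ θ' i = var j

theorem HeadFixed.wh_lift {θ θ' : Fin m → Term n} {b : Term m} (hb : HeadFixed θ θ' b)
    {c : Term n} (h : Wh (subst θ b) c) : ∃ b', Wh b b' ∧ c = subst θ b' := by
  induction b generalizing n with
  | var i =>
    obtain ⟨j, hj, _⟩ := hb i rfl
    rw [subst_var, hj] at h
    cases h
  | lam b => cases h
  | app s t ih _ =>
    rw [subst_app] at h
    generalize hs : subst θ s = s' at h
    cases h with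
    | beta u _ =>
      cases s with
      | var i =>
        obtain ⟨j, hj, _⟩ := hb i rfl
        rw [subst_var, hj] at hs
        cases hs
      | app => cases hs
      | lam s =>
        simp only [subst_lam, lam.injEq] at hs
        subst hs
        exact ⟨_, .beta s t, (subst_inst _ _ _).symm⟩
    | appL _ h =>
      subst hs
      obtain ⟨s', hs', rfl⟩ := ih hb h
      exact ⟨_, .appL t hs', rfl⟩

/-- Weak head reductions of `M`-instances are weak head reductions of terms with variables, up to
replacements of `M` in head position by `N`. -/
theorem Swapping.whRed_lift {M N : Term 0} {θ θ' : Fin m → Term n} (hθ : Swapping M N θ θ')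
    {E : Term n → Term n → Prop} (refl : ∀ a, E a a) (trans : ∀ a b c, E a b → E b c → E a c)
    (expand : ∀ a b, Wh a b → E b a) (swap : ∀ ts, E (apps (emb M) ts) (apps (emb N) ts))
    {b : Term m} {c : Term n} (h : WhRed (subst θ b) c) :
    ∃ b', c = subst θ b' ∧ HeadFixed θ θ' b' ∧ E (subst θ' b') (subst θ' b) := by
  have fix : ∀ b : Term m, ∃ b', subst θ b' = subst θ b ∧ HeadFixed θ θ' b' ∧
      E (subst θ' b') (subst θ' b) := by
    intro b
    cases hb : headVar b with
    | none => exact ⟨b, rfl, fun i hi => by simp [hb] at hi, refl _⟩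
    | some i =>
      rcases hθ i with hi | ⟨h₁, h₂⟩
      · refine ⟨b, rfl, fun i' hi' => ?_, refl _⟩
        rw [hb] at hi'
        cases hi'
        exact hi
      · obtain ⟨ts, rfl⟩ := eq_apps_of_headVar hb
        refine ⟨apps (emb M) ts, ?_, fun i hi => ?_, ?_⟩
        · simp [subst_apps, h₁]
        · rw [headVar_apps, headVar_emb] at hi
          cases hi
        · simpa [subst_apps, h₂] using swap _
  induction h with
  | refl =>
    obtain ⟨b', h₁, h₂, h₃⟩ := fix b
    exact ⟨b', h₁.symm, h₂, h₃⟩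
  | tail _ h ih =>
    obtain ⟨b₁, rfl, hb₁, hE₁⟩ := ih
    obtain ⟨b₂, hb₂, rfl⟩ := hb₁.wh_lift h
    obtain ⟨b₃, h₁, h₂, h₃⟩ := fix b₂
    exact ⟨b₃, h₁.symm, h₂, trans _ _ _ h₃ (trans _ _ _ (expand _ _ (hb₂.subst θ')) hE₁)⟩

theorem conv_of_app_var {s t : Term n}
    (h : BetaEtaConv (app (rename Fin.succ s) (var 0)) (app (rename Fin.succ t) (var 0))) :
    BetaEtaConv s t :=
  (Eta.eta s).conv.symm.trans (h.lam.trans (Eta.eta t).conv)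

end

/-- The context `z ↦ z t₁ ⋯ tₖ`, as a closed term. -/
def applicator (ts : List (Term 0)) : Term 0 := lam (apps (var 0) (ts.map (rename Fin.succ)))

theorem applicator_conv (ts : List (Term 0)) (s : Term 0) :
    BetaEtaConv (app (applicator ts) s) (apps s ts) := by
  have h : List.map (subst (single s) ∘ rename Fin.succ) ts = ts :=
    (List.map_congr_left (g := id) fun t _ => inst_rename_succ t s).trans (List.map_id ts)
  have := (Beta.beta (apps (var 0) (ts.map (rename Fin.succ))) s).conv
  rwa [inst_eq, subst_apps, List.map_map, h] at this

/-- In all contexts, the first of two closed terms yields at least the stable terms that the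
second one yields. -/
def StableLE (M N : Term 0) : Prop :=
  ∀ G S : Term 0, Stable S → BetaEtaConv (app G M) S → BetaEtaConv (app G N) S

theorem stable_apps_cons {M N : Term 0} (h : ∀ R, StableLE (app M R) (app N R)) {n : ℕ}
    (t : Term n) (ts : List (Term n)) {S : Term n} (hS : Stable S)
    (hM : BetaEtaConv (apps (emb M) (t :: ts)) S) : BetaEtaConv (apps (emb N) (t :: ts)) S := by
  have key : ∀ a : ℕ, ∃ V, BetaEtaRed (apps (emb N) (t :: ts)) V ∧
      subst (fun i : Fin n => (generic (2 * i + a) : Term 0)) V =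
        subst (fun i : Fin n => (generic (2 * i + a) : Term 0)) S := by
    intro a
    set σ : Fin n → Term 0 := fun i => generic (2 * i + a) with hσ
    have hr : Rigid σ := rigid_generic fun i : Fin n => 2 * (i : ℕ) + a
    have h₁ := hM.subst σ
    rw [subst_apps, subst_emb, emb_zero, List.map_cons] at h₁
    have h₂ := h (subst σ t) (applicator (ts.map (subst σ))) (subst σ S) (hS.subst hr)
      ((applicator_conv _ _).trans h₁)
    have h₃ := (applicator_conv _ _).symm.trans h₂
    have h₄ : BetaEtaConv (subst σ (apps (emb N) (t :: ts))) (subst σ S) := by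
      rw [subst_apps, subst_emb, emb_zero, List.map_cons]
      exact h₃
    obtain ⟨V, hV, hV'⟩ := hr.betaEtaRed_subst ((hS.subst hr).red_of_conv h₄)
    exact ⟨V, hV', hV.symm⟩
  obtain ⟨V₀, h₀, e₀⟩ := key 0
  obtain ⟨V₁, h₁, e₁⟩ := key 1
  obtain ⟨V, hV₀, hV₁⟩ := h₀.confluent h₁
  have hred : ∀ {a : ℕ} {W : Term n}, BetaEtaRed W V →
      subst (fun i : Fin n => (generic (2 * i + a) : Term 0)) W =
        subst (fun i : Fin n => (generic (2 * i + a) : Term 0)) S →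
      subst (fun i : Fin n => (generic (2 * i + a) : Term 0)) V =
        subst (fun i : Fin n => (generic (2 * i + a) : Term 0)) S := by
    intro a W hW e
    have := hW.subst (fun i : Fin n => (generic (2 * i + a) : Term 0))
    rw [e] at this
    exact (hS.subst (rigid_generic fun i : Fin n => 2 * (i : ℕ) + a)).eq_of_red this
  have hsep : Separating (fun i : Fin n => (generic (2 * i + 0) : Term 0))
      (fun i : Fin n => (generic (2 * i + 1) : Term 0)) := by
    refine ⟨fun i j hij => ?_, fun i => .inr ⟨i, rfl, rfl⟩⟩
    have := generic_injective hij
    exact Fin.ext (by omega)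
  obtain rfl := hsep.eq (hred hV₀ e₀) (hred hV₁ e₁)
  exact (h₀.trans hV₀).conv

theorem stable_apps {M N : Term 0} (h : ∀ R, StableLE (app M R) (app N R)) {n : ℕ}
    (ts : List (Term n)) {S : Term n} (hS : Stable S)
    (hM : BetaEtaConv (apps (emb M) ts) S) : BetaEtaConv (apps (emb N) ts) S := by
  cases ts with
  | cons t ts => exact stable_apps_cons h t ts hS hM
  | nil =>
    obtain ⟨S', hS', hred⟩ := ((QuasiStable.base hS).rename Fin.succ).app 0 |>.exists_stable
    have h₁ : BetaEtaConv (rename Fin.succ (emb M)) (rename Fin.succ S) := by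
      rw [rename_eq_subst, rename_eq_subst]
      exact hM.subst _
    rw [rename_emb] at h₁
    have h₂ := stable_apps_cons h (var 0) [] hS' ((h₁.app (.refl _)).trans hred.conv)
    refine conv_of_app_var ?_
    rw [show rename Fin.succ (apps (emb N : Term n) []) = emb N from rename_emb _ _]
    exact h₂.trans hred.conv.symm

theorem Swapping.conv_of_standard {M N : Term 0} (hMN : ∀ R, StableLE (app M R) (app N R))
    {n : ℕ} {a t : Term n} (h : Standard a t) :
    ∀ {m : ℕ} {θ θ' : Fin m → Term n} (b : Term m), Swapping M N θ θ' →
      a = subst θ b → QuasiStable t → BetaEtaConv (subst θ' b) t := by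
  have lift : ∀ {m n : ℕ} {θ θ' : Fin m → Term n} {b : Term m} {c t : Term n},
      Swapping M N θ θ' → QuasiStable t → WhRed (subst θ b) c →
      ∃ b', c = subst θ b' ∧ HeadFixed θ θ' b' ∧
        (BetaEtaConv (subst θ' b') t → BetaEtaConv (subst θ' b) t) := by
    intro m n θ θ' b c t hθ ht h
    obtain ⟨b', h₁, h₂, h₃⟩ := hθ.whRed_lift
      (E := fun u v => ∀ S, Stable S → BetaEtaConv u S → BetaEtaConv v S)
      (fun _ _ _ h => h) (fun _ _ _ h h' S hS hu => h' S hS (h S hS hu))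
      (fun _ _ h _ _ hu => h.toBeta.conv.trans hu)
      (fun ts S hS h => stable_apps hMN ts hS h) h
    refine ⟨b', h₁, h₂, fun h => ?_⟩
    obtain ⟨S, hS, hred⟩ := ht.exists_stable
    exact (h₃ S hS (h.trans hred.conv)).trans hred.conv.symm
  induction h with
  | var h =>
    rintro m θ θ' b hθ rfl ht
    obtain ⟨b', h₁, h₂, h₃⟩ := lift hθ ht h
    refine h₃ ?_
    cases b' with
    | var i =>
      obtain ⟨j, hj, hj'⟩ := h₂ i rfl
      rw [h₁, subst_var, subst_var, hj, hj']
      exact .refl _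
    | _ => cases h₁
  | lam h _ ih =>
    rintro m θ θ' b hθ rfl ht
    obtain ⟨b', h₁, h₂, h₃⟩ := lift hθ ht h
    refine h₃ ?_
    cases b' with
    | var i =>
      obtain ⟨j, hj, _⟩ := h₂ i rfl
      rw [subst_var, hj] at h₁
      cases h₁
    | app => cases h₁
    | lam b' =>
      simp only [subst_lam, lam.injEq] at h₁
      exact (ih b' hθ.up h₁ ht.of_lam).lam
  | app h _ _ ih₁ ih₂ =>
    rintro m θ θ' b hθ rfl ht
    obtain ⟨b', h₁, h₂, h₃⟩ := lift hθ ht h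
    refine h₃ ?_
    cases b' with
    | var i =>
      obtain ⟨j, hj, _⟩ := h₂ i rfl
      rw [subst_var, hj] at h₁
      cases h₁
    | lam => cases h₁
    | app b₁ b₂ =>
      simp only [subst_app, app.injEq] at h₁
      exact (ih₁ b₁ hθ h₁.1 ht.of_app.1).app (ih₂ b₂ hθ h₁.2 ht.of_app.2)
  | eta h _ ih =>
    rintro m θ θ' b hθ rfl ht
    obtain ⟨b', h₁, h₂, h₃⟩ := lift hθ ht h
    refine h₃ ?_
    cases b' with
    | var i =>
      obtain ⟨j, hj, _⟩ := h₂ i rfl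
      rw [subst_var, hj] at h₁
      cases h₁
    | app => cases h₁
    | lam b' =>
      simp only [subst_lam, lam.injEq] at h₁
      exact (ih b' hθ.up h₁ ((ht.rename _).app 0)).lam.trans (Eta.eta _).conv

/-- The substitution of a closed term for the only free variable. -/
theorem swapping_const (M N : Term 0) :
    Swapping M N (fun _ : Fin 1 => (emb M : Term 0)) (fun _ => emb N) :=
  fun _ => .inr ⟨rfl, rfl⟩

theorem subst_app_emb (G M : Term 0) :
    subst (fun _ : Fin 1 => (emb M : Term 0)) (app (emb G) (var 0)) = app G M := by
  simp

theorem stableLE_of_app {M N : Term 0} (h : ∀ R, StableLE (app M R) (app N R)) :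
    StableLE M N := by
  intro G S hS hM
  have := Swapping.conv_of_standard h (hS.red_of_conv hM).standard (app (emb G) (var 0))
    (swapping_const M N) (subst_app_emb G M).symm (.base hS)
  rwa [subst_app_emb] at this

theorem OmegaEq.stableLE {M N : Term 0} (h : OmegaEq M N) : StableLE M N ∧ StableLE N M := by
  induction h with
  | conv h =>
    exact ⟨fun G S _ h' => ((BetaEtaConv.refl G).app h.symm).trans h',
      fun G S _ h' => ((BetaEtaConv.refl G).app h).trans h'⟩
  | @app P M N _ ih =>
    have key : ∀ G K : Term 0, BetaEtaConv
        (Term.app (lam (Term.app (emb G) (Term.app (emb P) (var 0)))) K)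
        (Term.app G (Term.app P K)) := by
      intro G K
      simpa using (Beta.beta (Term.app (emb G) (Term.app (emb P) (var 0))) K).conv
    exact ⟨fun G S hS h => (key _ _).symm.trans (ih.1 _ S hS ((key _ _).trans h)),
      fun G S hS h => (key _ _).symm.trans (ih.2 _ S hS ((key _ _).trans h))⟩
  | symm _ ih => exact ih.symm
  | trans _ _ ih₁ ih₂ =>
    exact ⟨fun G S hS h => ih₂.1 G S hS (ih₁.1 G S hS h),
      fun G S hS h => ih₁.2 G S hS (ih₂.2 G S hS h)⟩
  | omega _ ih => exact ⟨stableLE_of_app fun R => (ih R).1, stableLE_of_app fun R => (ih R).2⟩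

/-- The existence of a `βη`-normal form. -/
def HasNormalForm {n : ℕ} (A : Term n) : Prop := ∃ K, BetaEtaRed A K ∧ IsNormal K

theorem HasNormalForm.of_conv {n : ℕ} {A B : Term n} (hA : HasNormalForm A)
    (h : BetaEtaConv A B) : HasNormalForm B := by
  obtain ⟨K, hK, hn⟩ := hA
  exact ⟨K, (Stable.of_isNormal hn).red_of_conv (h.symm.trans hK.conv), hn⟩

/-- A closed term that has a normal form is equal in `λω` only to the terms convertible to it. -/
theorem OmegaEq.conv_of_hasNormalForm {M N : Term 0} (h : OmegaEq M N) (hM : HasNormalForm M) :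
    BetaEtaConv M N := by
  obtain ⟨K, hK, hn⟩ := hM
  have key : ∀ A : Term 0, BetaEtaConv (Term.app (lam (var 0)) A) A :=
    fun A => (Beta.beta (var 0) A).conv
  exact hK.conv.trans ((key N).symm.trans
    (h.stableLE.1 _ K (.of_isNormal hn) ((key M).trans hK.conv))).symm

theorem leafBody_zero (Y : Term 2) (L : List (Term 1)) (Z : Fin 0 → Term (1 + 0)) :
    leafBody Y L Z = headPart Y L := by
  rw [leafBody, List.ofFn_zero]
  exact rename_id _

theorem leafBodyEta_zero (Y : Term 2) (L : List (Term 1)) :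
    leafBodyEta Y L 0 = headPart Y L := by
  rw [leafBodyEta, boundVars, List.ofFn_zero]
  exact rename_id _

theorem inst_headPart (Y : Term 2) (L : List (Term 1)) (N : Term 0) :
    inst (headPart Y L) N = apps (inst (lam Y) N) (L.map (inst · N)) := subst_apps _ _ _

theorem exists_isNormalFormOrSelf (A : Term 0) : ∃ J, IsNormalFormOrSelf A J ∧ BetaEtaRed A J := by
  by_cases h : HasNormalForm A
  · obtain ⟨J, hJ, hn⟩ := h
    exact ⟨J, .inl ⟨hJ, hn⟩, hJ⟩
  · exact ⟨A, .inr ⟨h, rfl⟩, .refl A⟩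

theorem BetaEtaRed.apps_map {α : Type*} {f g : α → Term 0} (h : ∀ a, BetaEtaRed (f a) (g a))
    (l : List α) {s s' : Term 0} (hs : BetaEtaRed s s') :
    BetaEtaRed (apps s (l.map f)) (apps s' (l.map g)) := by
  induction l generalizing s s' with
  | nil => exact hs
  | cons a l ih => exact ih (hs.app (h a))

theorem canonicalComponent_of {Y : Term 2} {L : List (Term 1)} {M N K H H' J₀ : Term 0}
    {J : List (Term 0)} (hK : NonHeadRed (inst (headPart Y L) M) K) (hH : EtaRed K H)
    (hJ₀ : IsNormalFormOrSelf (inst (lam Y) N) J₀)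
    (hJ : List.Forall₂ (fun l j => IsNormalFormOrSelf (inst l N) j) L J)
    (hN : BetaEtaRed (inst (headPart Y L) N) (apps J₀ J)) (hH' : BetaEtaRed (apps J₀ J) H') :
    CanonicalComponent (lam (headPart Y L)) M N H H' := by
  refine ⟨Y, L, 0, Fin.elim0, ?_, ?_, ?_⟩
  · rw [leafBody_zero]
  · rw [leafBody_zero]
    exact ⟨K, hK, hH⟩
  · rw [RightStructure, leafBody_zero, leafBodyEta_zero]
    exact ⟨.single (.inl (.beta _ _)), .refl _, .refl, J₀, J, hJ₀, hJ, hN, hH'⟩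

theorem exists_canonicalComponent {X : Set (Term 0)} (hX : Cofinal X) {Y : Term 2}
    {L : List (Term 1)} {M K H : Term 0} (N : Term 0)
    (hK : NonHeadRed (inst (headPart Y L) M) K) (hH : EtaRed K H) :
    ∃ H' ∈ X, CanonicalComponent (lam (headPart Y L)) M N H H' ∧
      BetaEtaRed (inst (headPart Y L) N) H' := by
  choose nf hnf hred using exists_isNormalFormOrSelf
  obtain ⟨H', hH', hr⟩ := hX (apps (nf (inst (lam Y) N)) (L.map fun l => nf (inst l N)))
  have hN : BetaEtaRed (inst (headPart Y L) N)
      (apps (nf (inst (lam Y) N)) (L.map fun l => nf (inst l N))) := by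
    rw [inst_headPart]
    exact BetaEtaRed.apps_map (fun _ => hred _) L (hred _)
  refine ⟨H', hH', canonicalComponent_of hK hH (hnf _) ?_ hN hr, hN.trans hr⟩
  rw [List.forall₂_map_right_iff]
  exact List.forall₂_same.2 fun l _ => hnf _

theorem NonHeadBeta.toBeta {n : ℕ} {s t : Term n} (h : NonHeadBeta s t) : Beta s t := by
  induction h with
  | lam _ ih => exact .lam ih
  | appR s h => exact .appR s h
  | appLam t h => exact .appL t (.lam h)
  | appL t _ ih => exact .appL t ih

theorem CanonicalComponent.left {G M N H H' : Term 0} (h : CanonicalComponent G M N H H') :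
    BetaEtaRed (app G M) H := by
  obtain ⟨Y, L, n, Z, rfl, ⟨K, hK, hH⟩, _⟩ := h
  exact .head (.inl (.beta _ _))
    (.trans (BetaRed.betaEtaRed (mono_red (fun _ _ => NonHeadBeta.toBeta) hK)) hH.betaEtaRed)

theorem CanonicalComponent.right {G M N H H' : Term 0} (h : CanonicalComponent G M N H H') :
    BetaEtaRed (app G N) H' := by
  obtain ⟨Y, L, n, Z, rfl, _, h₁, h₂, h₃, J₀, J, _, _, h₄, h₅⟩ := h
  exact h₁.trans (h₂.trans (h₃.betaEtaRed.trans (h₄.trans h₅)))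

variable {X : Set (Term 0)}

/-- The existence of an `X`-canonical proof. -/
def Can (X : Set (Term 0)) (F F' : Term 0) : Prop := ∃ T : ProofTree F F', T.IsCanonical X

/-- Confluence terms that are joined by a component of an `X`-canonical endpiece. -/
def Link (X : Set (Term 0)) (H H' : Term 0) : Prop :=
  H ∈ X ∧ H' ∈ X ∧ ∃ G M N, CanonicalComponent G M N H H' ∧ ∀ R, Can X (app M R) (app N R)

/-- The existence of an `X`-canonical endpiece. -/
def EndpieceCan (X : Set (Term 0)) (F F' : Term 0) : Prop :=
  ∃ H H', H ∈ X ∧ H' ∈ X ∧ BetaEtaRed F H ∧ BetaEtaRed F' H' ∧ ReflTransGen (Link X) H H'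

theorem exists_components {H H' : Term 0} (hH' : H' ∈ X) (h : ReflTransGen (Link X) H H') :
    ∃ (t : ℕ) (G M N : Fin t → Term 0) (K : Fin (t + 1) → Term 0),
      K 0 = H ∧ K (Fin.last t) = H' ∧ (∀ i, K i ∈ X) ∧
      (∀ i, CanonicalComponent (G i) (M i) (N i) (K i.castSucc) (K i.succ)) ∧
      ∀ i R, Can X (app (M i) R) (app (N i) R) := by
  induction h using ReflTransGen.head_induction_on with
  | refl =>
    exact ⟨0, Fin.elim0, Fin.elim0, Fin.elim0, fun _ => H', rfl, rfl, fun _ => hH',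
      fun i => i.elim0, fun i => i.elim0⟩
  | @head A B h _ ih =>
    obtain ⟨t, G, M, N, K, hK₀, hK₁, hKX, hc, hl⟩ := ih
    obtain ⟨hA, hB, G₀, M₀, N₀, hc₀, hl₀⟩ := h
    refine ⟨t + 1, Fin.cons G₀ G, Fin.cons M₀ M, Fin.cons N₀ N, Fin.cons A K, rfl, ?_, ?_, ?_, ?_⟩
    · rw [← Fin.succ_last, Fin.cons_succ, hK₁]
    · intro i
      cases i using Fin.cases with
      | zero => exact hA
      | succ i => exact hKX i
    · intro i
      cases i using Fin.cases with
      | zero =>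
        simp only [Fin.cons_zero, Fin.castSucc_zero, Fin.cons_succ, hK₀]
        exact hc₀
      | succ i =>
        simp only [Fin.cons_succ, ← Fin.succ_castSucc]
        exact hc i
    · intro i
      cases i using Fin.cases with
      | zero => exact hl₀
      | succ i => exact hl i

theorem EndpieceCan.can {F F' : Term 0} (h : EndpieceCan X F F') : Can X F F' := by
  obtain ⟨H, H', _, hH', hF, hF', h⟩ := h
  obtain ⟨t, G, M, N, K, rfl, rfl, hKX, hc, hl⟩ := exists_components hH' h
  choose leaf hleaf using hl
  exact ⟨.endpiece t G M N K hF (fun i => (hc i).left) (fun i => (hc i).right) hF' leaf,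
    hKX, hc, hleaf⟩

theorem EndpieceCan.of_conv (hX : Cofinal X) {F F' : Term 0} (h : BetaEtaConv F F') :
    EndpieceCan X F F' := by
  obtain ⟨W, hW, hW'⟩ := h.join
  obtain ⟨H, hH, hWH⟩ := hX W
  exact ⟨H, H, hH, hH, hW.trans hWH, hW'.trans hWH, .refl⟩

theorem link_of_can {H H' : Term 0} (hH : H ∈ X) (hH' : H' ∈ X) (hn : ¬ HasNormalForm H')
    (h : ∀ R, Can X (app H R) (app H' R)) : Link X H H' := by
  refine ⟨hH, hH', lam (headPart (app (var 1) (var 0)) []), H, H', ?_, h⟩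
  have hη : ∀ A : Term 0,
      Eta (inst (headPart (app (var 1) (var 0)) []) A) A := fun A => Eta.eta A
  refine canonicalComponent_of (J₀ := inst (headPart (app (var 1) (var 0)) []) H') .refl
    (.single (hη H)) (.inr ⟨fun hK => hn (HasNormalForm.of_conv hK (hη H').conv), rfl⟩) .nil
    (.refl _) (.single (.inr (hη H')))

theorem EndpieceCan.trans (hX : Cofinal X) {F F' F'' : Term 0} (hn : ¬ HasNormalForm F')
    (h : EndpieceCan X F F') (h' : EndpieceCan X F' F'') : EndpieceCan X F F'' := by
  obtain ⟨H, H₁, hH, hH₁, hF, hF₁, hp⟩ := h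
  obtain ⟨H₂, H₃, hH₂, hH₃, hF₂, hF₃, hp'⟩ := h'
  refine ⟨H, H₃, hH, hH₃, hF, hF₃, (hp.tail ?_).trans hp'⟩
  exact link_of_can hH₁ hH₂ (fun h => hn (h.of_conv hF₂.conv.symm)) fun R =>
    (EndpieceCan.of_conv hX ((hF₁.conv.symm.trans hF₂.conv).app (.refl R))).can

/-- Equations of `λω` that have an `X`-canonical endpiece, unless the terms have a normal form. -/
def Good (X : Set (Term 0)) (F F' : Term 0) : Prop :=
  OmegaEq F F' ∧ (¬ HasNormalForm F → EndpieceCan X F F')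

theorem OmegaEq.not_hasNormalForm {F F' : Term 0} (h : OmegaEq F F') (hF : ¬ HasNormalForm F) :
    ¬ HasNormalForm F' :=
  fun hn => hF (hn.of_conv (h.symm.conv_of_hasNormalForm hn))

namespace Good

theorem of_conv (hX : Cofinal X) {F F' : Term 0} (h : BetaEtaConv F F') : Good X F F' :=
  ⟨.conv h, fun _ => .of_conv hX h⟩

theorem can (hX : Cofinal X) {F F' : Term 0} (h : Good X F F') : Can X F F' := by
  by_cases hF : HasNormalForm F
  · exact (EndpieceCan.of_conv hX (h.1.conv_of_hasNormalForm hF)).can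
  · exact (h.2 hF).can

theorem trans (hX : Cofinal X) {F F' F'' : Term 0} (h : Good X F F') (h' : Good X F' F'') :
    Good X F F'' :=
  ⟨h.1.trans h'.1, fun hF =>
    (h.2 hF).trans hX (h.1.not_hasNormalForm hF) (h'.2 (h.1.not_hasNormalForm hF))⟩

theorem congr_conv (hX : Cofinal X) {A F F' A' : Term 0} (h : Good X F F')
    (hA : BetaEtaConv A F) (hA' : BetaEtaConv F' A') : Good X A A' :=
  ((of_conv hX hA).trans hX h).trans hX (of_conv hX hA')

theorem omega (hX : Cofinal X) {F F' : Term 0} (h : ∀ R, Good X (app F R) (app F' R)) :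
    Good X F F' := by
  have hω : OmegaEq F F' := .omega fun R => (h R).1
  refine ⟨hω, fun hF => ?_⟩
  obtain ⟨H, hH, hFH⟩ := hX F
  obtain ⟨H', hH', hFH'⟩ := hX F'
  refine ⟨H, H', hH, hH', hFH, hFH', .single (link_of_can hH hH'
    (fun hn => hω.not_hasNormalForm hF (hn.of_conv hFH'.conv.symm)) fun R => ?_)⟩
  exact ((h R).congr_conv hX (hFH.conv.symm.app (.refl R)) (hFH'.conv.app (.refl R))).can hX

theorem of_component (hX : Cofinal X) {M N : Term 0} (h : ∀ R, Good X (app M R) (app N R))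
    {Y : Term 2} {L : List (Term 1)} {K H : Term 0} (hH : H ∈ X)
    (hK : NonHeadRed (inst (headPart Y L) M) K) (hη : EtaRed K H) :
    Good X (inst (headPart Y L) M) (inst (headPart Y L) N) := by
  refine ⟨?_, fun _ => ?_⟩
  · have hβ : ∀ A, OmegaEq (app (lam (headPart Y L)) A) (inst (headPart Y L) A) :=
      fun A => .conv (Beta.beta _ A).conv
    exact (hβ M).symm.trans ((OmegaEq.app _ (.omega fun R => (h R).1)).trans (hβ N))
  · obtain ⟨H', hH', hc, hr⟩ := exists_canonicalComponent hX N hK hη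
    refine ⟨H, H', hH, hH', ?_, hr, .single ⟨hH, hH', _, M, N, hc, fun R => (h R).can hX⟩⟩
    exact .trans (BetaRed.betaEtaRed (mono_red (fun _ _ => NonHeadBeta.toBeta) hK)) hη.betaEtaRed

end Good

theorem Internal.nonHead {n : ℕ} {s t : Term n} (h : Internal s t) (hs : ∀ P, s ≠ .lam P) :
    NonHeadBeta s t ∧ ∀ P, t ≠ .lam P := by
  induction h with
  | lam h => exact (hs _ rfl).elim
  | appR s h => exact ⟨.appR s h, fun P hP => (by cases hP)⟩
  | appL t h ih =>
    refine ⟨?_, fun P hP => (by cases hP)⟩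
    cases h with
    | lam h => exact .appLam t h
    | appR _ _ => exact .appL t (ih fun P hP => by cases hP).1
    | appL _ _ => exact .appL t (ih fun P hP => by cases hP).1

theorem nonHeadRed_of_internal {n : ℕ} {s t : Term n} (h : ReflTransGen Internal s t)
    (hs : ∀ P, s ≠ lam P) : NonHeadRed s t := by
  induction h using ReflTransGen.head_induction_on with
  | refl => exact .refl
  | head h _ ih => exact .head (h.nonHead hs).1 (ih (h.nonHead hs).2)

theorem exists_headPart {b : Term 1} (h : headVar b = none) : ∃ Y L, b = headPart Y L := by
  suffices ∀ {n : ℕ} (b : Term n), headVar b = none → ∃ Y L, b = apps (lam Y) L from this b h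
  intro n b h
  induction b with
  | var i => cases h
  | lam Y => exact ⟨Y, [], rfl⟩
  | app s t ih _ =>
    obtain ⟨Y, L, rfl⟩ := ih h
    exact ⟨Y, L ++ [t], (apps_append_singleton _ _ _).symm⟩

/-- Good equations in all contexts. -/
def GoodIn (X : Set (Term 0)) (M N : Term 0) : Prop := ∀ G, Good X (app G M) (app G N)

section
variable {M N : Term 0}

theorem GoodIn.good (hX : Cofinal X) (h : GoodIn X M N) : Good X M N := by
  have key : ∀ A : Term 0, BetaEtaConv (app (lam (var 0)) A) A :=
    fun A => (Beta.beta (var 0) A).conv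
  exact (h _).congr_conv hX (key M).symm (key N)

theorem good_apps (hX : Cofinal X) (h : ∀ R, GoodIn X (app M R) (app N R)) (ts : List (Term 0)) :
    Good X (apps M ts) (apps N ts) := by
  cases ts with
  | nil => exact .omega hX fun R => (h R).good hX
  | cons t ts =>
    exact (h t (applicator ts)).congr_conv hX (applicator_conv ts (app M t)).symm
      (applicator_conv ts (app N t))

theorem good_app_of_isZeroTerm (hX : Cofinal X) (h : ∀ R, GoodIn X (app M R) (app N R))
    {G : Term 0} (hG : IsZeroTerm (app G M)) : Good X (app G M) (app G N) := by
  obtain ⟨H, hH, hr⟩ := hX (app G M)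
  obtain ⟨C, K, hC, hK, hη⟩ := hr.standard.factor
  have hC₀ : ∀ P, C ≠ lam P := by
    rintro P rfl
    exact hG P hC.betaRed
  rw [← subst_app_emb G M] at hC
  obtain ⟨b, rfl, hb, hgood⟩ := (swapping_const M N).whRed_lift (E := Good X)
    (fun a => .of_conv hX (.refl a)) (fun _ _ _ h h' => h.trans hX h')
    (fun _ _ h => .of_conv hX h.toBeta.conv.symm)
    (fun ts => by simpa using good_apps hX h ts) hC
  have hb₀ : headVar b = none := by
    cases hi : headVar b with
    | none => rfl
    | some i =>
      obtain ⟨j, _⟩ := hb i hi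
      exact j.elim0
  obtain ⟨Y, L, rfl⟩ := exists_headPart hb₀
  have hs : ∀ A : Term 0, (fun _ : Fin 1 => (emb A : Term 0)) = single A := by
    intro A
    funext i
    rw [Fin.fin_one_eq_zero i, emb_zero, single_zero]
  rw [subst_app_emb, hs, ← inst_eq] at hgood
  rw [subst_app_emb, hs, ← inst_eq] at hC
  rw [hs, ← inst_eq] at hK hC₀
  exact ((Good.of_component hX (fun R => (h R).good hX) hH
    (nonHeadRed_of_internal hK hC₀) hη).congr_conv hX hC.betaRed.betaEtaRed.conv
      (.refl _)).trans hX hgood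

theorem good_app_of_zeroAfter (hX : Cofinal X) (h : ∀ R, GoodIn X (app M R) (app N R)) {p : ℕ}
    {G : Term 0} (hG : ZeroAfter p (app G M)) : Good X (app G M) (app G N) := by
  induction p generalizing G with
  | zero => exact good_app_of_isZeroTerm hX h hG
  | succ p ih =>
    refine .omega hX fun R => ?_
    have hβ : ∀ A, Beta (app (lam (app (app (emb G) (var 0)) (emb R))) A) (app (app G A) R) := by
      intro A
      simpa using Beta.beta (app (app (emb G) (var 0)) (emb R)) A
    exact (ih ((hG R).of_betaRed (.single (hβ M)))).congr_conv hX (hβ M).conv.symm (hβ N).conv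

theorem good_app_of_not_reducesToZero (hX : Supercofinal X)
    (h : ∀ R, GoodIn X (app M R) (app N R)) {G : Term 0} (hG : ¬ ReducesToZero (app G M)) :
    Good X (app G M) (app G N) := by
  have hβ : ∀ A, BetaEtaConv (inst (headPart (app (emb G) (var 0)) [var 0]) A) (app G A) := by
    intro A
    change BetaEtaConv (app (inst (lam (app (emb G) (var 0))) A) A) _
    simpa [inst_eq] using (Beta.beta (app (emb G) (var 0)) A).conv
  exact (Good.of_component hX.1 (fun R => (h R).good hX.1)
    (hX.2 _ fun hz => hG (ReducesToZero.of_conv hz (hβ M))) .refl .refl).congr_conv hX.1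
      (hβ M).symm (hβ N)

theorem goodIn_of_app (hX : Supercofinal X) (h : ∀ R, GoodIn X (app M R) (app N R)) :
    GoodIn X M N := by
  intro G
  by_cases hG : ReducesToZero (app G M)
  · obtain ⟨p, hp⟩ := hG.zeroAfter
    exact good_app_of_zeroAfter hX.1 h hp
  · exact good_app_of_not_reducesToZero hX h hG

theorem OmegaEq.goodIn (hX : Supercofinal X) (h : OmegaEq M N) :
    GoodIn X M N ∧ GoodIn X N M := by
  induction h with
  | conv h =>
    exact ⟨fun G => .of_conv hX.1 ((BetaEtaConv.refl G).app h),
      fun G => .of_conv hX.1 ((BetaEtaConv.refl G).app h.symm)⟩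
  | app P _ ih =>
    have key : ∀ G K : Term 0, BetaEtaConv
        (Term.app (lam (Term.app (emb G) (Term.app (emb P) (var 0)))) K)
        (Term.app G (Term.app P K)) := by
      intro G K
      simpa using (Beta.beta (Term.app (emb G) (Term.app (emb P) (var 0))) K).conv
    exact ⟨fun G => (ih.1 _).congr_conv hX.1 (key _ _).symm (key _ _),
      fun G => (ih.2 _).congr_conv hX.1 (key _ _).symm (key _ _)⟩
  | symm _ ih => exact ih.symm
  | trans _ _ ih₁ ih₂ =>
    exact ⟨fun G => (ih₁.1 G).trans hX.1 (ih₂.1 G), fun G => (ih₂.2 G).trans hX.1 (ih₁.2 G)⟩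
  | omega _ ih => exact ⟨goodIn_of_app hX fun R => (ih R).1, goodIn_of_app hX fun R => (ih R).2⟩

end

end LambdaOmega

theorem mainTheorem4 (X : Set (LambdaOmega.Term 0)) (hX : LambdaOmega.Supercofinal X)
    (M N : LambdaOmega.Term 0) (h : LambdaOmega.OmegaEq M N) :
    ∃ T : LambdaOmega.ProofTree M N, T.IsCanonical X :=
  ((h.goodIn hX).1.good hX.1).can hX.1
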